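/- Let $m,n\ge 1$, let $\mathbb F_n^+$ be the free semigroup on generators $g_1,\dots,g_n$ with identity $g_0$, and for $X=(X_1,\dots,X_n)\in B(\mathcal H)^n$ and $\alpha=g_{i_1}\cdots g_{i_k}$ put $X_\alpha:=X_{i_1}\cdots X_{i_k}$, $X_{g_0}:=I$, $|\alpha|:=k$. Let $\mathcal H$ be a complex Hilbert space and let $f=\sum_\alpha a_\alpha X_\alpha$ be a positive regular free holomorphic function on a ball $\{X\in B(\mathcal H)^n:\|\sum_i X_iX_i^*\|<\rho\}$, $\rho>0$; that is, $a_\alpha\ge 0$, $a_{g_0}=0$, $a_{g_i}>0$ for $i=1,\dots,n$, and $\sum_k\sum_{|\alpha|=k}a_\alpha X_\alpha$ converges in norm at each point of the ball. Put $b_{g_0}:=1$ and $$b_\alpha:=\sum_{j=1}^{|\alpha|}\ \sum_{\gamma_1\cdots\gamma_j=\alpha,\ |\gamma_i|\ge 1} a_{\gamma_1}\cdots a_{\gamma_j}\binom{j+m-1}{m-1}\qquad(|\alpha|\ge 1).$$ Let $F^2(H_n)$ be the full Fock space with orthonormal basis $(e_\alpha)_{\alpha\in\mathbb F_n^+}$,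 and let $W_1,\dots,W_n\in B(F^2(H_n))$ be the weighted left creation operators $W_ie_\alpha=\sqrt{b_\alpha/b_{g_i\alpha}}\;e_{g_i\alpha}$. For a Hilbert space $\mathcal K$ and $X\in B(\mathcal K)^n$ let $\Phi_{f,X}(Y):=\sum_{|\alpha|\ge1}a_\alpha X_\alpha YX_\alpha^*$ (WOT convergence), and let $\mathbf D_f^m(\mathcal K)$ be the set of all $X\in B(\mathcal K)^n$ such that $\sum_{|\alpha|\ge 1} a_\alpha X_\alpha X_\alpha^*$ is WOT convergent and $(\mathrm{id}-\Phi_{f,X})^k(I)\ge 0$ for $1\le k\le m$. A tuple $X\in\mathbf D_f^m(\mathcal K)$ is pure if $\Phi_{f,X}^k(I)\to0$ strongly as $k\to\infty$, and has the radial property if there is $\delta\in(0,1)$ with $rX\in\mathbf D_f^m(\mathcal K)$ for all $r\in(\delta,1)$. Let $F_n^\infty(\mathbf D_f^m)$ be the set of all $g\in B(F^2(H_n))$ for which there are $c_\beta\in\mathbb C$ with $\sum_\beta|c_\beta|^2/b_\beta<\infty$ and $gp=\sum_\beta c_\beta W_\beta p$ for every $p$ in the linear span of $\{e_\alpha\}$;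 we write $g=\sum_\beta c_\beta W_\beta$. Let $T=(T_1,\dots,T_n)\in\mathbf D_f^m(\mathcal H)$ be pure. Let $\Delta:=[(\mathrm{id}-\Phi_{f,T})^m(I)]^{1/2}$, let $K:\mathcal H\to F^2(H_n)\otimes\mathcal H$, $Kh:=\sum_\alpha\sqrt{b_\alpha}\,e_\alpha\otimes\Delta T_\alpha^*h$, be the noncommutative Berezin kernel, and let $\widetilde{\mathbf B}_T[g]:=K^*(g\otimes I_{\mathcal H})K$ for $g\in B(F^2(H_n))$. Then $K$ is a well-defined bounded operator, $F_n^\infty(\mathbf D_f^m)$ is a unital subalgebra of $B(F^2(H_n))$, and the map $\Psi_T:F_n^\infty(\mathbf D_f^m)\to B(\mathcal H)$, $\Psi_T(g):=\widetilde{\mathbf B}_T[g]$, has the following properties. (i) $\Psi_T$ is WOT-continuous and SOT-continuous on bounded sets: its restriction to every norm-bounded subset of $F_n^\infty(\mathbf D_f^m)$ is continuous from WOT to WOT and from SOT to SOT. (ii) $\Psi_T$ is a unital completely contractive homomorphism, and $W_\alpha\in F_n^\infty(\mathbf D_f^m)$, $\Psi_T(W_\alpha)=T_\alpha$ for all $\alpha\in\mathbb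 F_n^+$. If, in addition, $(W_1,\dots,W_n)$ has the radial property in $\mathbf D_f^m(F^2(H_n))$, then for every $g=\sum_\beta c_\beta W_\beta$ in $F_n^\infty(\mathbf D_f^m)$ the series $g(rT):=\sum_{k=0}^\infty\sum_{|\alpha|=k}c_\alpha r^{|\alpha|}T_\alpha$ converges in the operator norm for every $r\in(0,1)$, and $\Psi_T(g)=\text{SOT-}\lim_{r\to1^-}g(rT)$. -/

import Mathlib

open Filter Topology ContinuousLinearMap
open scoped TensorProduct

noncomputable section

/-- The product `X_α = X_{i₁} ⋯ X_{i_k}` along a word `α = g_{i₁} ⋯ g_{i_k}` of the free semigroup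
on `n` generators; words are lists over `Fin n`, and `X_∅ = I`. -/
def wordOp {n : ℕ} {H : Type*} [NormedAddCommGroup H] [InnerProductSpace ℂ H]
    (X : Fin n → H →L[ℂ] H) (α : List (Fin n)) : H →L[ℂ] H :=
  (α.map X).prod

/-- The partial sum `∑_{k < N} ∑_{|α| = k} c_α X_α` of a noncommutative power series. -/
def ncPartialSum {n : ℕ} {H : Type*} [NormedAddCommGroup H] [InnerProductSpace ℂ H]
    (c : List (Fin n) → ℂ) (X : Fin n → H →L[ℂ] H) (N : ℕ) : H →L[ℂ] H :=
  ∑ k ∈ Finset.range N, ∑ w : Fin k → Fin n, c (List.ofFn w) • wordOp X (List.ofFn w)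

/-- The coefficients of a positive regular noncommutative power series `f = ∑ a_α X_α`:
`a_α ≥ 0`, `a_∅ = 0`, and `a_{g_i} > 0` for every generator. -/
structure PosRegularSeries (n : ℕ) where
  a : List (Fin n) → ℝ
  nonneg : ∀ α, 0 ≤ a α
  nil : a [] = 0
  pos : ∀ i, 0 < a [i]

/-- `f` is free holomorphic on the ball `{X ∈ B(H)^n : ‖X₁X₁* + ⋯ + X_nX_n*‖ < ρ}`: the series
`∑_k ∑_{|α|=k} a_α X_α` converges in the operator norm at every point of the ball. -/
def PosRegularSeries.FreeHolomorphicOn {n : ℕ} (f : PosRegularSeries n) (H : Type*)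
    [NormedAddCommGroup H] [InnerProductSpace ℂ H] [CompleteSpace H] (ρ : ℝ) : Prop :=
  ∀ X : Fin n → H →L[ℂ] H, ‖∑ i, X i ∘L adjoint (X i)‖ < ρ →
    ∃ L, Tendsto (ncPartialSum (fun α => (f.a α : ℂ)) X) atTop (𝓝 L)

/-- The coefficients of `(1 - f)^{-m}`:
`b_α = ∑_j ∑_{γ₁⋯γ_j = α, |γ_i| ≥ 1} a_{γ₁} ⋯ a_{γ_j} binom(j+m-1, m-1)`.
The factorizations of `α` into nonempty words correspond to the compositions of `|α|`; for the
empty word the sum is the single empty product, so `b_∅ = 1`. -/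
def bCoeff {n : ℕ} (f : PosRegularSeries n) (m : ℕ) (α : List (Fin n)) : ℝ :=
  ∑ c : Composition α.length,
    ((α.splitWrtComposition c).map f.a).prod * ((c.length + m - 1).choose (m - 1) : ℝ)

/-- The full Fock space `F²(H_n)`, with the orthonormal basis `(e_α)` indexed by words. -/
abbrev Fock (n : ℕ) : Type := lp (fun _ : List (Fin n) => ℂ) 2

/-- The basis vector `e_α`. -/
def fockBasis {n : ℕ} (α : List (Fin n)) : Fock n := lp.single 2 α (1 : ℂ)

theorem bCoeff_nil {n : ℕ} (f : PosRegularSeries n) (m : ℕ) : bCoeff f m [] = 1 := by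
  have h : ∀ c : Composition ([] : List (Fin n)).length, c.blocks = [] := fun c =>
    c.blocks_eq_nil.2 rfl
  have hu : (Finset.univ : Finset (Composition ([] : List (Fin n)).length)) =
      {Composition.ones 0} :=
    Finset.eq_singleton_iff_unique_mem.2 ⟨Finset.mem_univ _, fun c _ =>
      Composition.ext ((h c).trans (h (Composition.ones 0)).symm)⟩
  rw [bCoeff, hu, Finset.sum_singleton]
  simp [List.splitWrtComposition, List.splitWrtCompositionAux]

theorem le_bCoeff_cons {n : ℕ} (f : PosRegularSeries n) (m : ℕ) (i : Fin n) (α : List (Fin n)) :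
    f.a [i] * bCoeff f m α ≤ bCoeff f m (i :: α) := by
  let φ : Composition α.length → Composition (i :: α).length := fun c =>
    ⟨1 :: c.blocks, by
      intro j hj
      rcases List.mem_cons.1 hj with rfl | hj
      · exact one_pos
      · exact c.blocks_pos hj, by simp [c.blocks_sum, add_comm]⟩
  have hφ : Function.Injective φ := fun c d h =>
    Composition.ext (List.cons_injective (congrArg Composition.blocks h))
  have hnn : ∀ L : List (List (Fin n)), 0 ≤ (L.map f.a).prod := fun L =>
    List.prod_nonneg (by
      intro x hx
      obtain ⟨γ, -, rfl⟩ := List.mem_map.1 hx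
      exact f.nonneg γ)
  have hterm : ∀ c : Composition α.length,
      f.a [i] * (((α.splitWrtComposition c).map f.a).prod *
        ((c.length + m - 1).choose (m - 1) : ℝ)) ≤
      (((i :: α).splitWrtComposition (φ c)).map f.a).prod *
        (((φ c).length + m - 1).choose (m - 1) : ℝ) := by
    intro c
    have h1 : (i :: α).splitWrtComposition (φ c) = [i] :: α.splitWrtComposition c := by
      simp [List.splitWrtComposition, φ, List.splitWrtCompositionAux]
    have h2 : c.length ≤ (φ c).length := by simp [Composition.length, φ]
    rw [h1, List.map_cons, List.prod_cons, mul_assoc]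
    refine mul_le_mul_of_nonneg_left (mul_le_mul_of_nonneg_left ?_ (hnn _)) (f.nonneg _)
    exact_mod_cast Nat.choose_le_choose _ (by omega)
  calc f.a [i] * bCoeff f m α
      ≤ ∑ c, (((i :: α).splitWrtComposition (φ c)).map f.a).prod *
        (((φ c).length + m - 1).choose (m - 1) : ℝ) := by
        rw [bCoeff, Finset.mul_sum]
        exact Finset.sum_le_sum fun c _ => hterm c
    _ ≤ bCoeff f m (i :: α) := by
        rw [bCoeff, ← Finset.sum_image (f := fun d : Composition (i :: α).length =>
          (((i :: α).splitWrtComposition d).map f.a).prod *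
            ((d.length + m - 1).choose (m - 1) : ℝ)) (fun c _ d _ h => hφ h)]
        exact Finset.sum_le_sum_of_subset_of_nonneg (Finset.subset_univ _) fun d _ _ =>
          mul_nonneg (hnn _) (Nat.cast_nonneg _)

theorem bCoeff_pos {n : ℕ} (f : PosRegularSeries n) (m : ℕ) (α : List (Fin n)) :
    0 < bCoeff f m α := by
  induction α with
  | nil => simp [bCoeff_nil]
  | cons i α ih => exact (mul_pos (f.pos i) ih).trans_le (le_bCoeff_cons f m i α)

/-- The weight `√b_α / √b_{g_i α}` of the weighted left creation operator `W_i`. -/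
def shiftWeight {n : ℕ} (f : PosRegularSeries n) (m : ℕ) (i : Fin n) (α : List (Fin n)) : ℝ :=
  √(bCoeff f m α) / √(bCoeff f m (i :: α))

theorem shiftWeight_le {n : ℕ} (f : PosRegularSeries n) (m : ℕ) (i : Fin n) (α : List (Fin n)) :
    shiftWeight f m i α ≤ √(f.a [i])⁻¹ := by
  rw [shiftWeight, ← Real.sqrt_div (bCoeff_pos f m α).le]
  refine Real.sqrt_le_sqrt ?_
  rw [div_le_iff₀ (bCoeff_pos f m _), inv_mul_eq_div, le_div_iff₀ (f.pos i), mul_comm]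
  exact le_bCoeff_cons f m i α

/-- The sequence of coordinates of `W_i x`: the coordinate at `g_i α` is the weight times `x_α`,
and the coordinates at words not starting with `g_i` vanish. -/
def shiftFun {n : ℕ} (f : PosRegularSeries n) (m : ℕ) (i : Fin n) (x : List (Fin n) → ℂ) :
    List (Fin n) → ℂ
  | [] => 0
  | j :: α => if j = i then (shiftWeight f m i α : ℂ) * x α else 0

theorem hasSum_shiftFun {n : ℕ} (f : PosRegularSeries n) (m : ℕ) (i : Fin n) (x : Fock n) :
    ∃ s ≤ (√(f.a [i])⁻¹ * ‖x‖) ^ 2, HasSum (fun β => ‖shiftFun f m i x β‖ ^ 2) s := by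
  have hx : HasSum (fun α => ‖x α‖ ^ 2) (‖x‖ ^ 2) := by
    simpa using lp.hasSum_norm (p := 2) (by simp) x
  have hle : ∀ α, ‖(shiftWeight f m i α : ℂ) * x α‖ ^ 2 ≤ (√(f.a [i])⁻¹) ^ 2 * ‖x α‖ ^ 2 := by
    intro α
    have h0 : 0 ≤ shiftWeight f m i α := div_nonneg (Real.sqrt_nonneg _) (Real.sqrt_nonneg _)
    rw [norm_mul, mul_pow, Complex.norm_real, Real.norm_of_nonneg h0]
    gcongr
    exact shiftWeight_le f m i α
  have hsum : Summable fun α => ‖(shiftWeight f m i α : ℂ) * x α‖ ^ 2 :=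
    Summable.of_nonneg_of_le (fun _ => sq_nonneg _) hle (hx.summable.mul_left _)
  refine ⟨_, ?_, (Function.Injective.hasSum_iff (g := List.cons i) (a := ∑' α, ‖(shiftWeight f m i α : ℂ) * x α‖ ^ 2)
    List.cons_injective ?_).1 ?_⟩
  · rw [mul_pow, ← hx.tsum_eq, ← tsum_mul_left]
    exact hsum.tsum_le_tsum hle (hx.summable.mul_left _)
  · intro β hβ
    cases β with
    | nil => simp [shiftFun]
    | cons j α =>
      have : j ≠ i := by
        rintro rfl
        exact hβ ⟨α, rfl⟩
      simp [shiftFun, this]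
  · simpa [Function.comp_def, shiftFun] using hsum.hasSum

/-- The weighted left creation operator: `W_i e_α = (√b_α / √b_{g_i α}) e_{g_i α}`
(see `weightedShift_basis`). -/
def weightedShift {n : ℕ} (f : PosRegularSeries n) (m : ℕ) (i : Fin n) : Fock n →L[ℂ] Fock n :=
  LinearMap.mkContinuous
    { toFun := fun x => ⟨shiftFun f m i x, memℓp_gen (by
        obtain ⟨s, -, hs⟩ := hasSum_shiftFun f m i x
        simpa using hs.summable)⟩
      map_add' := fun x y => by
        ext β
        change shiftFun f m i (x + y) β = shiftFun f m i x β + shiftFun f m i y β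
        rcases β with _ | ⟨j, α⟩
        · simp [shiftFun]
        · simp only [shiftFun, Pi.add_apply]
          split_ifs <;> ring
      map_smul' := fun c x => by
        ext β
        change shiftFun f m i (c • x) β = c * shiftFun f m i x β
        rcases β with _ | ⟨j, α⟩
        · simp [shiftFun]
        · simp only [shiftFun, Pi.smul_apply, smul_eq_mul]
          split_ifs <;> ring }
    (√(f.a [i])⁻¹) fun x => by
      obtain ⟨s, hle, hs⟩ := hasSum_shiftFun f m i x
      refine lp.norm_le_of_tsum_le (p := 2) (by simp) (by positivity) ?_
      simpa using hs.tsum_eq.le.trans hle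

theorem weightedShift_basis {n : ℕ} (f : PosRegularSeries n) (m : ℕ) (i : Fin n)
    (α : List (Fin n)) :
    weightedShift f m i (fockBasis α) = (shiftWeight f m i α : ℂ) • fockBasis (i :: α) := by
  ext β
  change shiftFun f m i (fockBasis α) β = (shiftWeight f m i α : ℂ) * fockBasis (i :: α) β
  rcases β with _ | ⟨j, γ⟩
  · simp [shiftFun, fockBasis]
  · by_cases hj : j = i
    · subst hj
      by_cases hγ : γ = α
      · subst hγ; simp [shiftFun, fockBasis]
      · simp [shiftFun, fockBasis, hγ]
    · simp [shiftFun, fockBasis, hj]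

section Hilbert

variable {n : ℕ} {H : Type*} [NormedAddCommGroup H] [InnerProductSpace ℂ H] [CompleteSpace H]

/-- The terms `a_α X_α Y X_α*` of `Φ_{f,X}(Y)`, as elements of `B(H)` with the weak operator
topology. The term of the empty word vanishes. -/
def phiTerm (f : PosRegularSeries n) (X : Fin n → H →L[ℂ] H) (Y : H →L[ℂ] H)
    (α : List (Fin n)) : H →WOT[ℂ] H :=
  .ofCLM ((f.a α : ℂ) • (wordOp X α ∘L Y ∘L adjoint (wordOp X α)))

/-- `Φ_{f,X}(Y) = ∑_{|α| ≥ 1} a_α X_α Y X_α*`, the sum being taken in the weak operator topology. -/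
def phi (f : PosRegularSeries n) (X : Fin n → H →L[ℂ] H) (Y : H →L[ℂ] H) : H →L[ℂ] H :=
  (∑' α, phiTerm f X Y α).toCLM

/-- `(id - Φ_{f,X})^k (I)`. -/
def defectPow (f : PosRegularSeries n) (k : ℕ) (X : Fin n → H →L[ℂ] H) : H →L[ℂ] H :=
  (fun Y => Y - phi f X Y)^[k] 1

/-- The noncommutative domain `D_f^m(H)`: the series `∑ a_α X_α X_α*` is WOT-convergent and
`(id - Φ_{f,X})^k (I) ≥ 0` for `1 ≤ k ≤ m`. -/
def ncDomain (f : PosRegularSeries n) (m : ℕ) (H : Type*) [NormedAddCommGroup H]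
    [InnerProductSpace ℂ H] [CompleteSpace H] : Set (Fin n → H →L[ℂ] H) :=
  {X | Summable (phiTerm f X 1) ∧ ∀ k, 1 ≤ k → k ≤ m → (defectPow f k X).IsPositive}

/-- `T` is pure: `Φ_{f,T}^k(I) → 0` strongly. -/
def IsPure (f : PosRegularSeries n) (T : Fin n → H →L[ℂ] H) : Prop :=
  ∀ x, Tendsto (fun k : ℕ => ((phi f T)^[k] 1) x) atTop (𝓝 0)

/-- The radial property of a tuple `X` in `D_f^m(H)`: `rX ∈ D_f^m(H)` for all `r` in some
interval `(δ, 1)`, `0 < δ < 1`. -/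
def HasRadialProperty (f : PosRegularSeries n) (m : ℕ) (X : Fin n → H →L[ℂ] H) : Prop :=
  X ∈ ncDomain f m H ∧
    ∃ δ ∈ Set.Ioo (0 : ℝ) 1, ∀ r ∈ Set.Ioo δ 1, (fun i => (r : ℂ) • X i) ∈ ncDomain f m H

/-- The Hilbert space tensor product `F²(H_n) ⊗ H`. -/
abbrev FockTensor (n : ℕ) (H : Type*) [NormedAddCommGroup H] [InnerProductSpace ℂ H] : Type _ :=
  UniformSpace.Completion (Fock n ⊗[ℂ] H)

/-- The operator `g ⊗ I_H` on `F²(H_n) ⊗ H`. -/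
def ampliation (H : Type*) [NormedAddCommGroup H] [InnerProductSpace ℂ H]
    (g : Fock n →L[ℂ] Fock n) : FockTensor n H →L[ℂ] FockTensor n H :=
  (g.rTensor H).completion

/-- The defect operator `Δ_{f,m,T} = [(id - Φ_{f,T})^m(I)]^{1/2}`. -/
def defectOp (f : PosRegularSeries n) (m : ℕ) (T : Fin n → H →L[ℂ] H) : H →L[ℂ] H :=
  CFC.sqrt (defectPow f m T)

/-- The term `√b_α e_α ⊗ Δ_{f,m,T} T_α* h` of the series defining the Berezin kernel. -/
def kernelTerm (f : PosRegularSeries n) (m : ℕ) (T : Fin n → H →L[ℂ] H) (h : H)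
    (α : List (Fin n)) : FockTensor n H :=
  ((√(bCoeff f m α) : ℂ) • fockBasis α) ⊗ₜ[ℂ] defectOp f m T (adjoint (wordOp T α) h)

open Classical in
/-- The noncommutative Berezin kernel `K h = ∑_α √b_α e_α ⊗ Δ_{f,m,T} T_α* h`, the unique bounded
operator `H → F²(H_n) ⊗ H` given by this series (and `0` if the series does not define one). -/
def berezinKernel (f : PosRegularSeries n) (m : ℕ) (T : Fin n → H →L[ℂ] H) :
    H →L[ℂ] FockTensor n H :=
  if hK : ∃ K : H →L[ℂ] FockTensor n H, ∀ h, HasSum (kernelTerm f m T h) (K h)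
  then hK.choose else 0

/-- The extended noncommutative Berezin transform `g ↦ K* (g ⊗ I_H) K`. -/
def berezinTransform (f : PosRegularSeries n) (m : ℕ) (T : Fin n → H →L[ℂ] H)
    (g : Fock n →L[ℂ] Fock n) : H →L[ℂ] H :=
  adjoint (berezinKernel f m T) ∘L ampliation H g ∘L berezinKernel f m T

/-- The bounded operator `g` on the Fock space has the Fourier representation `∑_β c_β W_β`:
`∑ |c_β|² / b_β < ∞` and `g p = ∑_β c_β W_β p` for every polynomial `p`, i.e. for every finite
linear combination of the `e_α`. -/
def HasFourierRep (f : PosRegularSeries n) (m : ℕ) (g : Fock n →L[ℂ] Fock n)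
    (c : List (Fin n) → ℂ) : Prop :=
  Summable (fun β => ‖c β‖ ^ 2 / bCoeff f m β) ∧
    ∀ p ∈ Submodule.span ℂ (Set.range (fockBasis (n := n))),
      HasSum (fun β => c β • wordOp (weightedShift f m) β p) (g p)

/-- The Hardy algebra `F_n^∞(D_f^m)`, as a set of bounded operators on the Fock space. -/
def hardySet (f : PosRegularSeries n) (m : ℕ) : Set (Fock n →L[ℂ] Fock n) :=
  {g | ∃ c, HasFourierRep f m g c}

end Hilbert

/-- The weak operator topology on `B(H)`. -/
abbrev wot (H : Type*) [NormedAddCommGroup H] [InnerProductSpace ℂ H] :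
    TopologicalSpace (H →L[ℂ] H) :=
  .induced (fun A => (ContinuousLinearMapWOT.ofCLM A : H →WOT[ℂ] H)) inferInstance

/-- The strong operator topology on `B(H)`. -/
abbrev sot (H : Type*) [NormedAddCommGroup H] [InnerProductSpace ℂ H] :
    TopologicalSpace (H →L[ℂ] H) :=
  .induced (toPointwiseConvergenceCLM ℂ (RingHom.id ℂ) H H) inferInstance

/-- A `k × k` matrix of operators on `H`, as an operator on the Hilbert space direct sum `H^(k)`. -/
def matrixOp {k : ℕ} {H : Type*} [NormedAddCommGroup H] [InnerProductSpace ℂ H]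
    (A : Matrix (Fin k) (Fin k) (H →L[ℂ] H)) :
    PiLp 2 (fun _ : Fin k => H) →L[ℂ] PiLp 2 (fun _ : Fin k => H) :=
  (PiLp.continuousLinearEquiv 2 ℂ (fun _ : Fin k => H)).symm.toContinuousLinearMap ∘L
    ContinuousLinearMap.pi fun i => ∑ j, A i j ∘L PiLp.proj 2 (fun _ : Fin k => H) j

/-- A linear map `u` from an algebra of operators on `E` to `B(H)` is completely contractive:
`‖[u(x_ij)]‖ ≤ ‖[x_ij]‖` for all matrices over the algebra, of every size. -/
def IsCompletelyContractive {E H : Type*} [NormedAddCommGroup E] [InnerProductSpace ℂ E]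
    [NormedAddCommGroup H] [InnerProductSpace ℂ H] {A : Subalgebra ℂ (E →L[ℂ] E)}
    (u : A →ₗ[ℂ] (H →L[ℂ] H)) : Prop :=
  ∀ (k : ℕ) (x : Matrix (Fin k) (Fin k) A),
    ‖matrixOp (x.map u)‖ ≤ ‖matrixOp (x.map (fun y => (y : E →L[ℂ] E)))‖

end

/-! Everything rests on two properties of the kernel: `K` is an isometry, and `K* (W_α ⊗ I) = T_α
K*`. The isometry property is the identity `∑ b_α T_α Δ² T_α* = I`. Since `b_α` sums over the
factorizations of `α`, grouping by the number `j` of factors turns the left side into `∑_j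
binom(j+m-1, m-1) Φ^j((id - Φ)^m(I))`, the expansion of `(1 - z)^{-m} (1 - z)^m = 1` at `z = Φ`.
Positivity of the lower defects and purity justify this: the series is summed by telescoping `m`
times (`tsum_choose_mul_diff`). The intertwining relation is a cancellation of weights on the
vectors `e_α ⊗ h`.

Since `Ψ(g) = K* (g ⊗ I) K` compresses an ampliation by an isometry, complete contractivity and
continuity on bounded sets follow from the same facts for `g ↦ g ⊗ I`. Multiplicativity needs `K* (g
⊗ I) = Ψ(g) K*` on the whole Hardy algebra. This holds for polynomials in the `W_i` and must survive
a limit in which norms stay bounded.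

The limit comes from Schur multipliers. Membership in the Hardy algebra is a condition on matrix
entries (`hasFourierRep_iff`), and Schur multiplication by a Gram matrix of unit vectors is
contractive (`exists_schurMultiplier`). One Gram matrix extracts the homogeneous parts of `g`, so
each has norm at most `‖g‖`; another produces dilations `g_r = ∑ c_β r^{|β|} W_β` with `‖g_r‖ ≤
‖g‖`. Hence the series of `g_r` converges geometrically in norm, and `g_r ⊗ I → g ⊗ I` strongly as
`r → 1`. Applying `Ψ` to the same two limits gives norm convergence of `g(rT)` and its radial limit.
-/

noncomputable section

/-! ### Ampliations on the completed Hilbert tensor product -/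

section TensorAmplification

variable {E E' E'' H G : Type*} [NormedAddCommGroup E] [InnerProductSpace ℂ E]
  [NormedAddCommGroup E'] [InnerProductSpace ℂ E'] [NormedAddCommGroup E'']
  [InnerProductSpace ℂ E''] [NormedAddCommGroup H] [InnerProductSpace ℂ H]
  [NormedAddCommGroup G] [NormedSpace ℂ G]

/-- The completed Hilbert space tensor product. -/
abbrev HilbertTensor (E H : Type*) [NormedAddCommGroup E] [InnerProductSpace ℂ E]
    [NormedAddCommGroup H] [InnerProductSpace ℂ H] : Type _ :=
  UniformSpace.Completion (E ⊗[ℂ] H)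

/-- The elementary tensor `x ⊗ h` in the completed tensor product. -/
def elemTensor (x : E) (h : H) : HilbertTensor E H := ((x ⊗ₜ[ℂ] h : E ⊗[ℂ] H) : HilbertTensor E H)

/-- `A ⊗ I_H` between completed tensor products. -/
def ampl (H : Type*) [NormedAddCommGroup H] [InnerProductSpace ℂ H] (A : E →L[ℂ] E') :
    HilbertTensor E H →L[ℂ] HilbertTensor E' H :=
  (A.rTensor H).completion

/-- `I_E ⊗ Y` on the completed tensor product. -/
def amplRight (E : Type*) [NormedAddCommGroup E] [InnerProductSpace ℂ E] (Y : H →L[ℂ] H) :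
    HilbertTensor E H →L[ℂ] HilbertTensor E H :=
  (Y.lTensor E).completion

@[simp] theorem ampl_elemTensor (A : E →L[ℂ] E') (x : E) (h : H) :
    ampl H A (elemTensor x h) = elemTensor (A x) h := by
  simp [ampl, elemTensor, ContinuousLinearMap.completion_apply_coe]

@[simp] theorem amplRight_elemTensor (Y : H →L[ℂ] H) (x : E) (h : H) :
    amplRight E Y (elemTensor x h) = elemTensor x (Y h) := by
  simp [amplRight, elemTensor, ContinuousLinearMap.completion_apply_coe]

theorem inner_elemTensor (x y : E) (h k : H) :
    inner ℂ (elemTensor x h) (elemTensor y k) = inner ℂ x y * inner ℂ h k := by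
  simp [elemTensor]

theorem norm_elemTensor (x : E) (h : H) : ‖elemTensor x h‖ = ‖x‖ * ‖h‖ := by
  simp [elemTensor]

theorem elemTensor_add_left (x y : E) (h : H) :
    elemTensor (x + y) h = elemTensor x h + elemTensor y h := by
  simp only [elemTensor, TensorProduct.add_tmul, UniformSpace.Completion.coe_add]

theorem elemTensor_add_right (x : E) (h k : H) :
    elemTensor x (h + k) = elemTensor x h + elemTensor x k := by
  simp only [elemTensor, TensorProduct.tmul_add, UniformSpace.Completion.coe_add]

theorem elemTensor_smul_left (c : ℂ) (x : E) (h : H) :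
    elemTensor (c • x) h = c • elemTensor x h := by
  simp only [elemTensor, ← TensorProduct.smul_tmul', UniformSpace.Completion.coe_smul]

theorem elemTensor_smul_right (c : ℂ) (x : E) (h : H) :
    elemTensor x (c • h) = c • elemTensor x h := by
  simp only [elemTensor, TensorProduct.tmul_smul, UniformSpace.Completion.coe_smul]

theorem continuous_elemTensor_left (h : H) : Continuous fun x : E => elemTensor x h :=
  (UniformSpace.Completion.continuous_coe _).comp (by fun_prop)

theorem span_elemTensor_dense :
    Dense (Submodule.span ℂ (Set.range fun p : E × H => elemTensor p.1 p.2) :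
      Set (HilbertTensor E H)) := by
  refine (UniformSpace.Completion.denseRange_coe (α := E ⊗[ℂ] H)).mono ?_
  rintro _ ⟨t, rfl⟩
  induction t using TensorProduct.induction_on with
  | zero =>
    rw [UniformSpace.Completion.coe_zero]
    exact Submodule.zero_mem _
  | tmul x h => exact Submodule.subset_span ⟨(x, h), rfl⟩
  | add s t hs ht =>
    rw [UniformSpace.Completion.coe_add]
    exact Submodule.add_mem _ hs ht

/-- Bounded operators on a completed tensor product agree if they agree on elementary tensors. -/
theorem clm_ext_elemTensor {A B : HilbertTensor E H →L[ℂ] G}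
    (h : ∀ x k, A (elemTensor x k) = B (elemTensor x k)) : A = B :=
  ContinuousLinearMap.ext_on span_elemTensor_dense (by rintro _ ⟨p, rfl⟩; exact h _ _)

theorem ampl_comp (A : E' →L[ℂ] E'') (B : E →L[ℂ] E') :
    ampl H (A ∘L B) = ampl H A ∘L ampl H B :=
  clm_ext_elemTensor fun x k => by simp

theorem ampl_add (A B : E →L[ℂ] E') : ampl H (A + B) = ampl H A + ampl H B :=
  clm_ext_elemTensor fun x k => by simp [elemTensor_add_left]

theorem ampl_smul (c : ℂ) (A : E →L[ℂ] E') : ampl H (c • A) = c • ampl H A :=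
  clm_ext_elemTensor fun x k => by simp [elemTensor_smul_left]

theorem ampl_zero : ampl H (0 : E →L[ℂ] E') = 0 := by
  simpa using ampl_smul (H := H) 0 (0 : E →L[ℂ] E')

theorem ampl_id : ampl H (ContinuousLinearMap.id ℂ E) = ContinuousLinearMap.id ℂ _ :=
  clm_ext_elemTensor fun x k => by simp

theorem ampl_sum {ι : Type*} (s : Finset ι) (A : ι → E →L[ℂ] E') :
    ampl H (∑ i ∈ s, A i) = ∑ i ∈ s, ampl H (A i) :=
  map_sum (⟨⟨ampl H, ampl_zero⟩, ampl_add⟩ : (E →L[ℂ] E') →+ _) A s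

theorem norm_completion_le (A : E →L[ℂ] E') :
    ‖(A.completion : UniformSpace.Completion E →L[ℂ] UniformSpace.Completion E')‖ ≤ ‖A‖ := by
  refine ContinuousLinearMap.opNorm_le_bound _ (norm_nonneg _) fun x => ?_
  induction x using UniformSpace.Completion.induction_on with
  | hp => exact isClosed_le (by fun_prop) (by fun_prop)
  | ih x =>
    rw [ContinuousLinearMap.completion_apply_coe, UniformSpace.Completion.norm_coe,
      UniformSpace.Completion.norm_coe]
    exact A.le_opNorm x

theorem norm_ampl_le (A : E →L[ℂ] E') : ‖ampl H A‖ ≤ ‖A‖ :=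
  (norm_completion_le _).trans (ContinuousLinearMap.norm_rTensor_le _ _)

theorem inner_ampl_left [CompleteSpace E] [CompleteSpace E'] (A : E →L[ℂ] E')
    (ξ : HilbertTensor E H) (η : HilbertTensor E' H) :
    inner ℂ (ampl H A ξ) η = inner ℂ ξ (ampl H (adjoint A) η) := by
  -- Both variables are reduced to elementary tensors, one at a time: first the argument of the
  -- operator, then the test vector `η`.
  have h : ampl H A = adjoint (ampl H (adjoint A)) := by
    refine clm_ext_elemTensor fun x k => ?_
    refine ext_inner_right ℂ fun η => ?_
    rw [adjoint_inner_left]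
    have : innerSL ℂ (ampl H A (elemTensor x k)) =
        innerSL ℂ (elemTensor x k) ∘L ampl H (adjoint A) :=
      clm_ext_elemTensor fun y l => by simp [inner_elemTensor, adjoint_inner_right]
    exact congrArg (fun F => F η) this
  rw [h, adjoint_inner_left]

/-- A bounded family of operators that converges pointwise on a set with dense span converges
pointwise everywhere. -/
theorem tendsto_apply_of_dense_span {ι X : Type*} [NormedAddCommGroup X] [NormedSpace ℂ X]
    {l : Filter ι} {B : ι → X →L[ℂ] G} {B₀ : X →L[ℂ] G} {C : ℝ}
    (hB : ∀ᶠ i in l, ‖B i‖ ≤ C) {s : Set X} (hs : Dense (Submodule.span ℂ s : Set X))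
    (h : ∀ x ∈ s, Tendsto (fun i => B i x) l (𝓝 (B₀ x))) (x : X) :
    Tendsto (fun i => B i x) l (𝓝 (B₀ x)) := by
  have hspan : ∀ y ∈ Submodule.span ℂ s, Tendsto (fun i => B i y) l (𝓝 (B₀ y)) := by
    intro y hy
    induction hy using Submodule.span_induction with
    | mem y hy => exact h y hy
    | zero => simpa using tendsto_const_nhds
    | add y z _ _ hy hz => simpa using hy.add hz
    | smul c y _ hy => simpa using hy.const_smul c
  rw [Metric.tendsto_nhds]
  intro ε hε
  -- `D` bounds `‖B i‖ + ‖B₀‖`; the absolute value and the `1` make it positive without any sign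
  -- assumption on `C`.
  set D := |C| + ‖B₀‖ + 1 with hD
  have hD0 : 0 < D := by positivity
  obtain ⟨y, hy, hxy⟩ := Metric.dense_iff.1 hs x (ε / (2 * D)) (by positivity)
  rw [Metric.mem_ball, dist_comm, dist_eq_norm] at hy
  filter_upwards [hB, Metric.tendsto_nhds.1 (hspan y hxy) (ε / 2) (by positivity)] with i hi hiy
  rw [dist_eq_norm] at hiy ⊢
  have e : B i x - B₀ x = B i (x - y) - B₀ (x - y) + (B i y - B₀ y) := by
    simp only [map_sub]; abel
  have h1 : ‖B i (x - y)‖ ≤ |C| * ‖x - y‖ :=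
    (B i).le_of_opNorm_le (hi.trans (le_abs_self C)) _
  have h2 : ‖B₀ (x - y)‖ ≤ ‖B₀‖ * ‖x - y‖ := B₀.le_opNorm _
  have h3 : D * ‖x - y‖ < ε / 2 := by
    calc D * ‖x - y‖ < D * (ε / (2 * D)) := by gcongr
      _ = ε / 2 := by field_simp
  have h4 := norm_nonneg (x - y)
  calc ‖B i x - B₀ x‖ ≤ ‖B i (x - y)‖ + ‖B₀ (x - y)‖ + ‖B i y - B₀ y‖ := by
        rw [e]; exact (norm_add_le _ _).trans (by gcongr; exact norm_sub_le _ _)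
    _ < ε := by nlinarith

end TensorAmplification

/-! ### The Fock basis and column operators -/

section Fock

variable {n : ℕ} {H E : Type*} [NormedAddCommGroup H] [InnerProductSpace ℂ H]
  [NormedAddCommGroup E] [InnerProductSpace ℂ E]

theorem fockBasis_apply (α β : List (Fin n)) :
    (fockBasis α : Fock n) β = if β = α then 1 else 0 := by
  by_cases h : β = α
  · subst h; simp [fockBasis]
  · simp [fockBasis, h]

theorem inner_fockBasis_left (α : List (Fin n)) (x : Fock n) :
    inner ℂ (fockBasis α) x = x α := by
  simp [fockBasis, lp.inner_single_left]

theorem inner_fockBasis (α β : List (Fin n)) :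
    inner ℂ (fockBasis α) (fockBasis β) = if α = β then (1 : ℂ) else 0 := by
  rw [inner_fockBasis_left, fockBasis_apply]

theorem norm_fockBasis (α : List (Fin n)) : ‖(fockBasis α : Fock n)‖ = 1 := by
  simp [fockBasis, lp.norm_single]

theorem fockBasis_smul (c : ℂ) (α : List (Fin n)) : c • fockBasis α = lp.single 2 α c := by
  rw [fockBasis, ← lp.single_smul, smul_eq_mul, mul_one]

theorem hasSum_fockBasis (x : Fock n) : HasSum (fun α => x α • fockBasis α) x := by
  simpa only [fockBasis_smul] using lp.hasSum_single (p := 2) (by simp) x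

theorem span_fockBasis_dense :
    Dense (Submodule.span ℂ (Set.range (fockBasis (n := n))) : Set (Fock n)) := by
  intro x
  refine mem_closure_of_tendsto (hasSum_fockBasis x) (Eventually.of_forall fun s => ?_)
  exact Submodule.sum_mem _ fun α _ => Submodule.smul_mem _ _ (Submodule.subset_span ⟨α, rfl⟩)

/-- `x ↦ x ⊗ h` as a bounded operator. -/
def elemTensorLeft (h : H) : E →L[ℂ] HilbertTensor E H where
  toFun x := elemTensor x h
  map_add' x y := elemTensor_add_left x y h
  map_smul' c x := elemTensor_smul_left c x h
  cont := continuous_elemTensor_left h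

@[simp] theorem elemTensorLeft_apply (h : H) (x : E) : elemTensorLeft h x = elemTensor x h := rfl

theorem hasSum_elemTensor (x : Fock n) (h : H) :
    HasSum (fun α => x α • elemTensor (fockBasis α) h) (elemTensor x h) := by
  simpa using (elemTensorLeft h).hasSum (hasSum_fockBasis x)

theorem span_fockBasis_elemTensor_dense :
    Dense (Submodule.span ℂ (Set.range fun p : List (Fin n) × H =>
      elemTensor (fockBasis p.1) p.2) : Set (HilbertTensor (Fock n) H)) := by
  rw [Submodule.dense_iff_topologicalClosure_eq_top, eq_top_iff,
    ← Submodule.dense_iff_topologicalClosure_eq_top.1 (span_elemTensor_dense (E := Fock n) (H := H))]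
  refine Submodule.topologicalClosure_minimal _ (Submodule.span_le.2 ?_)
    (Submodule.isClosed_topologicalClosure _)
  rintro _ ⟨⟨x, h⟩, rfl⟩
  refine mem_closure_of_tendsto (hasSum_elemTensor x h) (Eventually.of_forall fun s => ?_)
  exact Submodule.sum_mem _ fun α _ =>
    Submodule.smul_mem _ _ (Submodule.subset_span ⟨(α, h), rfl⟩)

/-- `h ↦ e_α ⊗ h` as an isometry. -/
def fockSlice (H : Type*) [NormedAddCommGroup H] [InnerProductSpace ℂ H] (α : List (Fin n)) :
    H →ₗᵢ[ℂ] HilbertTensor (Fock n) H where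
  toFun h := elemTensor (fockBasis α) h
  map_add' h k := elemTensor_add_right _ h k
  map_smul' c h := elemTensor_smul_right c _ h
  norm_map' h := by simp [norm_elemTensor, norm_fockBasis]

/-- Orthogonality of the slices `e_α ⊗ H` is what turns norms of column sums into sums of squares.
-/
theorem orthogonalFamily_fockSlice :
    OrthogonalFamily ℂ (fun _ : List (Fin n) => H) (fockSlice H) := by
  intro α β hαβ h k
  change inner ℂ (elemTensor (fockBasis α) h) (elemTensor (fockBasis β) k) = 0
  rw [inner_elemTensor, inner_fockBasis, if_neg hαβ, zero_mul]

/-- A family of operators `A_α : E → H` that is square summable at every vector, with a uniform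
bound, assembles to a column operator `x ↦ ∑ e_α ⊗ A_α x`. -/
theorem exists_columnOp (A : List (Fin n) → E →L[ℂ] H) (C : ℝ)
    (hA : ∀ x, ∃ s ≤ C * ‖x‖ ^ 2, HasSum (fun α => ‖A α x‖ ^ 2) s) :
    ∃ V : E →L[ℂ] HilbertTensor (Fock n) H,
      ∀ x, HasSum (fun α => elemTensor (fockBasis α) (A α x)) (V x) := by
  have hsum : ∀ x, HasSum (fun α => elemTensor (fockBasis α) (A α x))
      (∑' α, elemTensor (fockBasis α) (A α x)) := by
    intro x
    obtain ⟨s, -, hs⟩ := hA x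
    exact ((orthogonalFamily_fockSlice (H := H)).summable_iff_norm_sq_summable
      (fun α => A α x)).2 hs.summable |>.hasSum
  have hnorm : ∀ x, ‖∑' α, elemTensor (fockBasis α) (A α x)‖ ≤ √C * ‖x‖ := by
    intro x
    obtain ⟨s, hle, hs⟩ := hA x
    have h1 : Tendsto (fun F : Finset (List (Fin n)) =>
        ‖∑ α ∈ F, elemTensor (fockBasis α) (A α x)‖ ^ 2) atTop (𝓝 s) := by
      refine hs.congr fun F => ?_
      exact ((orthogonalFamily_fockSlice (H := H)).norm_sum (fun α => A α x) F).symm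
    have h2 := tendsto_nhds_unique ((hsum x).norm.pow 2) h1
    rw [← Real.sqrt_sq (norm_nonneg x), ← Real.sqrt_mul' _ (sq_nonneg _)]
    exact Real.le_sqrt_of_sq_le (h2.trans_le hle)
  refine ⟨LinearMap.mkContinuous
    { toFun := fun x => ∑' α, elemTensor (fockBasis α) (A α x)
      map_add' := fun x y => ?_
      map_smul' := fun c x => ?_ } (√C) hnorm, hsum⟩
  · refine (hsum (x + y)).unique ?_
    simpa only [map_add, elemTensor_add_right] using (hsum x).add (hsum y)
  · refine (hsum (c • x)).unique ?_
    simpa only [map_smul, elemTensor_smul_right, RingHom.id_apply] using (hsum x).const_smul c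

theorem inner_columnOp {A : List (Fin n) → E →L[ℂ] H} {V : E →L[ℂ] HilbertTensor (Fock n) H}
    (hV : ∀ x, HasSum (fun α => elemTensor (fockBasis α) (A α x)) (V x)) (x : E)
    (α : List (Fin n)) (h : H) :
    inner ℂ (V x) (elemTensor (fockBasis α) h) = inner ℂ (A α x) h := by
  have h1 : HasSum (fun β => inner ℂ (elemTensor (fockBasis α) h)
      (elemTensor (fockBasis β) (A β x))) (inner ℂ (elemTensor (fockBasis α) h) (V x)) :=
    (innerSL ℂ (elemTensor (fockBasis α) h)).hasSum (hV x)
  have h2 := hasSum_single (f := fun β => inner ℂ (elemTensor (fockBasis α) h)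
      (elemTensor (fockBasis β) (A β x))) α fun β hβ => by
    rw [inner_elemTensor, inner_fockBasis, if_neg hβ.symm, zero_mul]
  have h3 := h1.unique h2
  rw [inner_elemTensor, inner_fockBasis, if_pos rfl, one_mul] at h3
  rw [← inner_conj_symm, h3, inner_conj_symm]

theorem adjoint_columnOp [CompleteSpace E] [CompleteSpace H] {A : List (Fin n) → E →L[ℂ] H}
    {V : E →L[ℂ] HilbertTensor (Fock n) H}
    (hV : ∀ x, HasSum (fun α => elemTensor (fockBasis α) (A α x)) (V x))
    (α : List (Fin n)) (h : H) :
    adjoint V (elemTensor (fockBasis α) h) = adjoint (A α) h := by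
  refine ext_inner_left ℂ fun x => ?_
  rw [adjoint_inner_right, adjoint_inner_right, inner_columnOp hV]

theorem hasSum_norm_sq_columnOp {A : List (Fin n) → E →L[ℂ] H}
    {V : E →L[ℂ] HilbertTensor (Fock n) H}
    (hV : ∀ x, HasSum (fun α => elemTensor (fockBasis α) (A α x)) (V x)) (x : E) :
    HasSum (fun α => ‖A α x‖ ^ 2) (‖V x‖ ^ 2) := by
  refine ((hV x).norm.pow 2).congr fun F => ?_
  exact (orthogonalFamily_fockSlice (H := H)).norm_sum (fun α => A α x) F

end Fock
-- The map `Φ`, its iterates, and the expansion of `(id - Φ)^{-m}`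
section Phi

variable {n : ℕ} {H : Type*} [NormedAddCommGroup H] [InnerProductSpace ℂ H]

theorem re_inner_apply_eq (Y : H →L[ℂ] H) (x : H) :
    (inner ℂ x (Y x)).re = Y.reApplyInnerSelf x := by
  rw [reApplyInnerSelf_apply]
  exact inner_re_symm (𝕜 := ℂ) _ _

theorem wordOp_append (X : Fin n → H →L[ℂ] H) (α β : List (Fin n)) :
    wordOp X (α ++ β) = wordOp X α ∘L wordOp X β := by
  simp [wordOp, ContinuousLinearMap.mul_def]

variable [CompleteSpace H]

/-- The functional `A ↦ ⟨y, A x⟩` on `B(H)` with the weak operator topology. -/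
def wotInner (x y : H) : (H →WOT[ℂ] H) →+ ℂ where
  toFun A := inner ℂ y (A x)
  map_zero' := by simp
  map_add' A B := by simp

theorem hasSum_wot_iff {ι : Type*} {A : ι → H →WOT[ℂ] H} {B : H →WOT[ℂ] H} :
    HasSum A B ↔ ∀ x y, HasSum (fun i => inner ℂ y (A i x)) (inner ℂ y (B x)) := by
  rw [HasSum, ContinuousLinearMapWOT.tendsto_iff_forall_inner_apply_tendsto]
  refine forall₂_congr fun x y => ?_
  have h : ∀ s : Finset ι, inner ℂ y ((∑ i ∈ s, A i) x) = ∑ i ∈ s, inner ℂ y (A i x) :=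
    fun s => map_sum (wotInner x y) A s
  simp only [h, HasSum]

theorem inner_phiTerm (f : PosRegularSeries n) (X : Fin n → H →L[ℂ] H) (Y : H →L[ℂ] H)
    (α : List (Fin n)) (x y : H) :
    inner ℂ y (phiTerm f X Y α x) =
      f.a α * inner ℂ (adjoint (wordOp X α) y) (Y (adjoint (wordOp X α) x)) := by
  change inner ℂ y ((f.a α : ℂ) • (wordOp X α (Y (adjoint (wordOp X α) x)))) = _
  rw [inner_smul_right, adjoint_inner_left]

/-- The squared norms of the entries `√a_α X_α* x` add up to `⟨x, L x⟩`, where `L` is the weak sum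
of `a_α X_α X_α*`, so `‖L‖` is the uniform bound that a column operator needs. -/
theorem exists_phiColumn (f : PosRegularSeries n) (X : Fin n → H →L[ℂ] H)
    (hX : Summable (phiTerm f X 1)) :
    ∃ V : H →L[ℂ] HilbertTensor (Fock n) H, ∀ x,
      HasSum (fun α => elemTensor (fockBasis α) (((√(f.a α) : ℂ) • adjoint (wordOp X α)) x))
        (V x) := by
  obtain ⟨L, hL⟩ := hX
  refine exists_columnOp _ ‖L.toCLM‖ fun x => ⟨(inner ℂ x (L x)).re, ?_, ?_⟩
  · calc (inner ℂ x (L x)).re ≤ ‖inner ℂ x (L.toCLM x)‖ := Complex.re_le_norm _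
      _ ≤ ‖x‖ * (‖L.toCLM‖ * ‖x‖) :=
        (norm_inner_le_norm _ _).trans (by gcongr; exact L.toCLM.le_opNorm x)
      _ = _ := by ring
  · have h := Complex.hasSum_re (hasSum_wot_iff.1 hL x x)
    have e : ∀ α, ‖((√(f.a α) : ℂ) • adjoint (wordOp X α)) x‖ ^ 2 =
        (inner ℂ x (phiTerm f X 1 α x)).re := by
      intro α
      rw [inner_phiTerm, Complex.re_ofReal_mul, one_apply_eq_self,
        ← RCLike.re_eq_complex_re, inner_self_eq_norm_sq, _root_.smul_apply, norm_smul, mul_pow,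
        Complex.norm_real, Real.norm_of_nonneg (Real.sqrt_nonneg _), Real.sq_sqrt (f.nonneg α)]
    simpa only [e] using h

/-- Convergence at `I` forces convergence at every bounded `Y`, because of the factorization `Φ(Y) =
V* (I ⊗ Y) V` through the column `V`. This excludes the default value of the `tsum` in `phi`. -/
theorem hasSum_phiTerm (f : PosRegularSeries n) {X : Fin n → H →L[ℂ] H}
    (hX : Summable (phiTerm f X 1)) (Y : H →L[ℂ] H) :
    HasSum (phiTerm f X Y) (.ofCLM (phi f X Y)) := by
  obtain ⟨V, hV⟩ := exists_phiColumn f X hX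
  suffices h : HasSum (phiTerm f X Y) (.ofCLM (adjoint V ∘L amplRight (Fock n) Y ∘L V)) by
    rw [phi, h.tsum_eq]; exact h
  rw [hasSum_wot_iff]
  intro x y
  have h1 := (innerSL ℂ (V y) ∘L amplRight (Fock n) Y).hasSum (hV x)
  have h2 : inner ℂ y ((ContinuousLinearMapWOT.ofCLM
      (adjoint V ∘L amplRight (Fock n) Y ∘L V) : H →WOT[ℂ] H) x) =
      (innerSL ℂ (V y) ∘L amplRight (Fock n) Y) (V x) := by
    change inner ℂ y (adjoint V (amplRight (Fock n) Y (V x))) = _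
    rw [adjoint_inner_right]; rfl
  rw [h2]
  refine h1.congr_fun fun α => ?_
  rw [inner_phiTerm]
  simp only [ContinuousLinearMap.comp_apply, innerSL_apply_apply, amplRight_elemTensor]
  rw [inner_columnOp hV]
  simp only [_root_.smul_apply, map_smul, inner_smul_left, inner_smul_right,
    Complex.conj_ofReal]
  rw [← mul_assoc, ← Complex.ofReal_mul, Real.mul_self_sqrt (f.nonneg α)]

theorem hasSum_inner_phi (f : PosRegularSeries n) {X : Fin n → H →L[ℂ] H}
    (hX : Summable (phiTerm f X 1)) (Y : H →L[ℂ] H) (x y : H) :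
    HasSum (fun α => (f.a α : ℂ) *
      inner ℂ (adjoint (wordOp X α) y) (Y (adjoint (wordOp X α) x)))
      (inner ℂ y (phi f X Y x)) := by
  simpa only [inner_phiTerm] using! hasSum_wot_iff.1 (hasSum_phiTerm f hX Y) x y

theorem phi_sub (f : PosRegularSeries n) {X : Fin n → H →L[ℂ] H}
    (hX : Summable (phiTerm f X 1)) (Y Z : H →L[ℂ] H) :
    phi f X (Y - Z) = phi f X Y - phi f X Z := by
  ext x
  refine ext_inner_left ℂ fun y => (hasSum_inner_phi f hX (Y - Z) x y).unique ?_
  have := (hasSum_inner_phi f hX Y x y).sub (hasSum_inner_phi f hX Z x y)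
  simpa only [_root_.sub_apply, inner_sub_right, mul_sub] using this

theorem phi_iterate_sub (f : PosRegularSeries n) {X : Fin n → H →L[ℂ] H}
    (hX : Summable (phiTerm f X 1)) (j : ℕ) (Y Z : H →L[ℂ] H) :
    (phi f X)^[j] (Y - Z) = (phi f X)^[j] Y - (phi f X)^[j] Z := by
  induction j generalizing Y Z with
  | zero => rfl
  | succ j ih => simp only [Function.iterate_succ_apply, phi_sub f hX, ih]

theorem hasSum_reApplyInnerSelf_phi (f : PosRegularSeries n) {X : Fin n → H →L[ℂ] H}
    (hX : Summable (phiTerm f X 1)) (Y : H →L[ℂ] H) (x : H) :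
    HasSum (fun α => f.a α * Y.reApplyInnerSelf (adjoint (wordOp X α) x))
      ((phi f X Y).reApplyInnerSelf x) := by
  have h := Complex.hasSum_re (hasSum_inner_phi f hX Y x x)
  simpa only [Complex.re_ofReal_mul, re_inner_apply_eq] using h

theorem reApplyInnerSelf_phi_nonneg (f : PosRegularSeries n) {X : Fin n → H →L[ℂ] H}
    (hX : Summable (phiTerm f X 1)) {Y : H →L[ℂ] H} (hY : ∀ x, 0 ≤ Y.reApplyInnerSelf x) (x : H) :
    0 ≤ (phi f X Y).reApplyInnerSelf x :=
  (hasSum_reApplyInnerSelf_phi f hX Y x).nonneg fun α => mul_nonneg (f.nonneg α) (hY _)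

theorem reApplyInnerSelf_phi_iterate_nonneg (f : PosRegularSeries n) {X : Fin n → H →L[ℂ] H}
    (hX : Summable (phiTerm f X 1)) {Y : H →L[ℂ] H} (hY : ∀ x, 0 ≤ Y.reApplyInnerSelf x) (j : ℕ)
    (x : H) : 0 ≤ ((phi f X)^[j] Y).reApplyInnerSelf x := by
  induction j generalizing x with
  | zero => exact hY x
  | succ j ih =>
    rw [Function.iterate_succ_apply']
    exact reApplyInnerSelf_phi_nonneg f hX ih x

theorem adjoint_wordOp_append (X : Fin n → H →L[ℂ] H) (α β : List (Fin n)) (x : H) :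
    adjoint (wordOp X (α ++ β)) x = adjoint (wordOp X β) (adjoint (wordOp X α) x) := by
  rw [wordOp_append, adjoint_comp]; rfl

/-- Iterating `Φ` prepends one factor `γ` to a `j`-tuple of words, and `X_{γω}* = X_ω* X_γ*`. All
terms are nonnegative, so working in `ENNReal` makes every regrouping free of summability
conditions. -/
theorem ofReal_reApplyInnerSelf_phi_iterate (f : PosRegularSeries n) {X : Fin n → H →L[ℂ] H}
    (hX : Summable (phiTerm f X 1)) {Y : H →L[ℂ] H} (hY : ∀ x, 0 ≤ Y.reApplyInnerSelf x) (j : ℕ)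
    (x : H) :
    ENNReal.ofReal (((phi f X)^[j] Y).reApplyInnerSelf x) =
      ∑' w : Fin j → List (Fin n), ENNReal.ofReal ((List.ofFn w).map f.a).prod *
        ENNReal.ofReal (Y.reApplyInnerSelf (adjoint (wordOp X (List.ofFn w).flatten) x)) := by
  induction j generalizing x with
  | zero => simp [wordOp, ← ContinuousLinearMap.star_eq_adjoint]
  | succ j ih =>
    have hpos := reApplyInnerSelf_phi_iterate_nonneg f hX hY j
    have hs := hasSum_reApplyInnerSelf_phi f hX ((phi f X)^[j] Y) x
    rw [Function.iterate_succ_apply', ← hs.tsum_eq,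
      ENNReal.ofReal_tsum_of_nonneg (fun α => mul_nonneg (f.nonneg α) (hpos _)) hs.summable,
      ← (Fin.consEquiv fun _ : Fin (j + 1) => List (Fin n)).tsum_eq, ENNReal.tsum_prod']
    refine tsum_congr fun γ => ?_
    rw [ENNReal.ofReal_mul (f.nonneg γ), ih, ← ENNReal.tsum_mul_left]
    refine tsum_congr fun w => ?_
    simp only [Fin.consEquiv, Equiv.coe_fn_mk, List.ofFn_cons, List.map_cons, List.prod_cons,
      List.flatten_cons]
    rw [ENNReal.ofReal_mul (f.nonneg γ), mul_assoc, adjoint_wordOp_append]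

theorem splitWrtComposition_sigma_injective {X : Type*} :
    Function.Injective fun s : (Σ α : List X, Composition α.length) =>
      s.1.splitWrtComposition s.2 := by
  rintro ⟨α, c⟩ ⟨β, d⟩ h
  simp only at h
  have h1 : α = β := by
    rw [← List.flatten_splitWrtComposition α c, h, List.flatten_splitWrtComposition]
  subst h1
  have h2 : c = d := Composition.ext <| by
    rw [← List.map_length_splitWrtComposition α c, h, List.map_length_splitWrtComposition]
  rw [h2]

/-- Summation against the coefficients `b_α` is summation over all factorizations. -/
theorem tsum_bCoeff_mul (f : PosRegularSeries n) (m : ℕ) (t : List (Fin n) → ENNReal) :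
    ∑' α, ENNReal.ofReal (bCoeff f m α) * t α =
      ∑' L : List (List (Fin n)), ENNReal.ofReal (L.map f.a).prod *
        ((L.length + m - 1).choose (m - 1) : ENNReal) * t L.flatten := by
  have hnn : ∀ L : List (List (Fin n)), 0 ≤ (L.map f.a).prod := fun L =>
    List.prod_nonneg (by
      intro x hx
      obtain ⟨γ, -, rfl⟩ := List.mem_map.1 hx
      exact f.nonneg γ)
  rw [← splitWrtComposition_sigma_injective.tsum_eq, ENNReal.tsum_sigma']
  · refine tsum_congr fun α => ?_
    rw [tsum_fintype, bCoeff, ENNReal.ofReal_sum_of_nonneg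
      (fun c _ => mul_nonneg (hnn _) (Nat.cast_nonneg _)), Finset.sum_mul]
    refine Finset.sum_congr rfl fun c _ => ?_
    rw [ENNReal.ofReal_mul (hnn _), ENNReal.ofReal_natCast, List.flatten_splitWrtComposition,
      List.length_splitWrtComposition]
  -- A list containing the empty word carries weight zero because `a_∅ = 0`; every other list is the
  -- splitting of its concatenation along a composition.
  · intro L hL
    have hmem : ∀ γ ∈ L, γ ≠ [] := by
      rintro γ hγ rfl
      apply hL
      have : (L.map f.a).prod = 0 := List.prod_eq_zero (List.mem_map.2 ⟨[], hγ, f.nil⟩)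
      simp [this]
    refine ⟨⟨L.flatten, ⟨L.map List.length, ?_, by simp [List.length_flatten]⟩⟩, ?_⟩
    · intro i hi
      obtain ⟨γ, hγ, rfl⟩ := List.mem_map.1 hi
      exact List.length_pos_iff.2 (hmem γ hγ)
    · exact List.splitWrtComposition_flatten L _ rfl

/-- Sorting factorizations by their number `j` of factors collects exactly the terms of `Φ^j(Y)`,
and the binomial coefficient depends on `j` alone. -/
theorem tsum_bCoeff_mul_reApplyInnerSelf (f : PosRegularSeries n) (m : ℕ) {X : Fin n → H →L[ℂ] H}
    (hX : Summable (phiTerm f X 1)) {Y : H →L[ℂ] H} (hY : ∀ x, 0 ≤ Y.reApplyInnerSelf x) (x : H) :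
    ∑' α, ENNReal.ofReal (bCoeff f m α) *
        ENNReal.ofReal (Y.reApplyInnerSelf (adjoint (wordOp X α) x)) =
      ∑' j : ℕ, ((j + m - 1).choose (m - 1) : ENNReal) *
        ENNReal.ofReal (((phi f X)^[j] Y).reApplyInnerSelf x) := by
  rw [tsum_bCoeff_mul f m fun α => ENNReal.ofReal (Y.reApplyInnerSelf (adjoint (wordOp X α) x)),
    ← (List.equivSigmaTuple (α := List (Fin n))).symm.tsum_eq, ENNReal.tsum_sigma']
  refine tsum_congr fun j => ?_
  rw [ofReal_reApplyInnerSelf_phi_iterate f hX hY, ← ENNReal.tsum_mul_left]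
  refine tsum_congr fun w => ?_
  simp only [List.equivSigmaTuple, Equiv.coe_fn_symm_mk, List.length_ofFn]
  ring

/-- Tonelli along antidiagonals: `u s` is met once for each `j ≤ s`. One use of this raises the
order of the binomial coefficients by one. -/
theorem tsum_mul_tsum_add (c u : ℕ → ENNReal) :
    ∑' j, c j * ∑' i, u (j + i) = ∑' s, (∑ j ∈ Finset.range (s + 1), c j) * u s := by
  calc ∑' j, c j * ∑' i, u (j + i) = ∑' p : ℕ × ℕ, c p.1 * u (p.1 + p.2) := by
        simp only [← ENNReal.tsum_mul_left]
        exact (ENNReal.tsum_prod (f := fun j i => c j * u (j + i))).symm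
    _ = ∑' s, ∑' p : Finset.HasAntidiagonal.antidiagonal s, c p.1.1 * u (p.1.1 + p.1.2) := by
        rw [← (Finset.HasAntidiagonal.sigmaAntidiagonalEquivProd (A := ℕ)).tsum_eq, ENNReal.tsum_sigma']
        rfl
    _ = _ := by
        refine tsum_congr fun s => ?_
        rw [Finset.tsum_subtype (Finset.HasAntidiagonal.antidiagonal s) fun p => c p.1 * u (p.1 + p.2),
          Finset.sum_mul, ← Finset.Nat.sum_antidiagonal_eq_sum_range_succ (fun i _ => c i * u s)]
        refine Finset.sum_congr rfl fun p hp => ?_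
        rw [Finset.HasAntidiagonal.mem_antidiagonal.1 hp]

/-- Iterated summation of a completely monotone null sequence. -/
theorem tsum_choose_mul_diff {q : ℕ → ℕ → ℝ} {m : ℕ} (hm : 1 ≤ m)
    (hq : ∀ k ≤ m, ∀ j, 0 ≤ q k j) (hdiff : ∀ k j, q (k + 1) j = q k j - q k (j + 1))
    (hlim : Tendsto (q 0) atTop (𝓝 0)) :
    ∑' j : ℕ, ((j + m - 1).choose (m - 1) : ENNReal) * ENNReal.ofReal (q m j) =
      ENNReal.ofReal (q 0 0) := by
  -- Each difference is at most the sequence it comes from, so all `q k` with `k ≤ m` inherit the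
  -- limit zero from `q 0`.
  have hle : ∀ k ≤ m, ∀ j, q k j ≤ q 0 j := by
    intro k
    induction k with
    | zero => intro _ j; exact le_rfl
    | succ k ih =>
      intro hk j
      rw [hdiff]
      linarith [ih (by omega) j, hq k (by omega) (j + 1)]
  -- Telescoping: a null sequence is the tail sum of its differences.
  have htail : ∀ k < m, ∀ j, ENNReal.ofReal (q k j) = ∑' i, ENNReal.ofReal (q (k + 1) (j + i)) := by
    intro k hk j
    have hl : Tendsto (q k) atTop (𝓝 0) :=
      squeeze_zero (hq k hk.le) (hle k hk.le) hlim
    have hs : HasSum (fun i => q (k + 1) (j + i)) (q k j) := by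
      rw [hasSum_iff_tendsto_nat_of_nonneg fun i => hq _ hk _]
      have h1 : ∀ N, ∑ i ∈ Finset.range N, q (k + 1) (j + i) = q k j - q k (j + N) := by
        intro N
        induction N with
        | zero => simp
        | succ N ih => rw [Finset.sum_range_succ, ih, hdiff]; ring_nf
      simp only [h1]
      have h2 : Tendsto (fun N => q k (j + N)) atTop (𝓝 0) :=
        hl.comp (tendsto_atTop_mono (fun N => Nat.le_add_left N j) tendsto_id)
      simpa using h2.const_sub (q k j)
    rw [← hs.tsum_eq, ENNReal.ofReal_tsum_of_nonneg (fun i => hq _ hk _) hs.summable]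
  have main : ∀ k, k + 1 ≤ m →
      ∑' j : ℕ, ((j + k).choose k : ENNReal) * ENNReal.ofReal (q (k + 1) j) =
        ENNReal.ofReal (q 0 0) := by
    intro k
    induction k with
    | zero => intro h; simp [htail 0 h 0]
    | succ k ih =>
      intro hk
      rw [← ih (by omega)]
      simp only [htail (k + 1) hk]
      rw [tsum_mul_tsum_add (fun j => ((j + k).choose k : ENNReal))
        fun i => ENNReal.ofReal (q (k + 1 + 1) i)]
      refine tsum_congr fun s => ?_
      -- The partial sums of `binom(j+k, k)` are given by the hockey-stick identity.
      rw [← Nat.cast_sum, Nat.sum_range_add_choose, add_assoc s]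
  obtain ⟨k, rfl⟩ : ∃ k, m = k + 1 := ⟨m - 1, by omega⟩
  exact main k le_rfl

/-- For a pure tuple in the domain, `∑ b_α T_α (id - Φ)^m(I) T_α* = I`. -/
theorem tsum_bCoeff_mul_defectPow (f : PosRegularSeries n) {m : ℕ} (hm : 1 ≤ m)
    {T : Fin n → H →L[ℂ] H} (hT : T ∈ ncDomain f m H) (hpure : IsPure f T) (x : H) :
    ∑' α, ENNReal.ofReal (bCoeff f m α) *
        ENNReal.ofReal ((defectPow f m T).reApplyInnerSelf (adjoint (wordOp T α) x)) =
      ENNReal.ofReal (‖x‖ ^ 2) := by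
  have hpos : ∀ k ≤ m, ∀ x, 0 ≤ (defectPow f k T).reApplyInnerSelf x := by
    intro k hk x
    rcases Nat.eq_zero_or_pos k with rfl | h0
    · exact isPositive_one.re_inner_nonneg_left x
    · exact (hT.2 k h0 hk).re_inner_nonneg_left x
  rw [tsum_bCoeff_mul_reApplyInnerSelf f m hT.1 (hpos m le_rfl)]
  -- Here `q k j = ⟨Φ^j((id - Φ)^k(I)) x, x⟩`: membership in the domain gives nonnegativity for `k ≤
  -- m`, purity gives `q 0 j → 0`, and `q 0 0 = ‖x‖²`.
  rw [tsum_choose_mul_diff (q := fun k j => ((phi f T)^[j] (defectPow f k T)).reApplyInnerSelf x) hm]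
  · simp [defectPow, reApplyInnerSelf_apply, inner_self_eq_norm_sq_to_K, ← Complex.ofReal_pow]
  · exact fun k hk j => reApplyInnerSelf_phi_iterate_nonneg f hT.1 (hpos k hk) j x
  · intro k j
    have : defectPow f (k + 1) T = defectPow f k T - phi f T (defectPow f k T) := by
      rw [defectPow, Function.iterate_succ_apply']; rfl
    simp only [this, phi_iterate_sub f hT.1, ← Function.iterate_succ_apply]
    simp [reApplyInnerSelf_apply, inner_sub_left]
  · have h := (Complex.continuous_re.tendsto _).comp
      ((hpure x).inner (tendsto_const_nhds (x := x)))
    simpa [Function.comp_def, reApplyInnerSelf_apply, defectPow] using h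

end Phi
-- The Berezin kernel: isometry and intertwining
section Kernel

variable {n : ℕ} {H : Type*} [NormedAddCommGroup H] [InnerProductSpace ℂ H] [CompleteSpace H]

theorem hasSum_of_tsum_ofReal {ι : Type*} {F : ι → ℝ} {s : ℝ} (hF : ∀ i, 0 ≤ F i) (hs : 0 ≤ s)
    (h : ∑' i, ENNReal.ofReal (F i) = ENNReal.ofReal s) : HasSum F s := by
  have hne : ∑' i, ENNReal.ofReal (F i) ≠ ⊤ := by rw [h]; exact ENNReal.ofReal_ne_top
  have h1 := ENNReal.hasSum_toReal hne
  rw [← ENNReal.tsum_toReal_eq fun i => ENNReal.ofReal_ne_top, h, ENNReal.toReal_ofReal hs] at h1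
  simpa only [ENNReal.toReal_ofReal (hF _)] using h1

theorem isSelfAdjoint_defectOp (f : PosRegularSeries n) (m : ℕ) (T : Fin n → H →L[ℂ] H) :
    IsSelfAdjoint (defectOp f m T) :=
  (CFC.sqrt_nonneg _).isSelfAdjoint

theorem norm_defectOp_sq (f : PosRegularSeries n) (m : ℕ) {T : Fin n → H →L[ℂ] H}
    (h : (defectPow f m T).IsPositive) (x : H) :
    ‖defectOp f m T x‖ ^ 2 = (defectPow f m T).reApplyInnerSelf x := by
  have h1 : defectOp f m T * defectOp f m T = defectPow f m T :=
    CFC.sqrt_mul_sqrt_self _ ((ContinuousLinearMap.nonneg_iff_isPositive _).2 h)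
  have h2 := (isSelfAdjoint_defectOp f m T).adjoint_eq
  rw [← re_inner_apply_eq, ← h1, mul_apply_eq_comp, ← adjoint_inner_left, h2,
    ← RCLike.re_eq_complex_re, inner_self_eq_norm_sq]

/-- The components of the Berezin kernel. -/
def kernelCoord (f : PosRegularSeries n) (m : ℕ) (T : Fin n → H →L[ℂ] H) (α : List (Fin n)) :
    H →L[ℂ] H :=
  (√(bCoeff f m α) : ℂ) • (defectOp f m T ∘L adjoint (wordOp T α))

theorem kernelTerm_eq (f : PosRegularSeries n) (m : ℕ) (T : Fin n → H →L[ℂ] H) (h : H)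
    (α : List (Fin n)) :
    kernelTerm f m T h α = elemTensor (fockBasis α) (kernelCoord f m T α h) := by
  simp only [kernelTerm, elemTensor, kernelCoord, _root_.smul_apply, TensorProduct.smul_tmul,
    ContinuousLinearMap.comp_apply]

/-- This is `∑ b_α T_α Δ² T_α* = I` read as a quadratic form. It makes the kernel series converge
and also makes its sum isometric. -/
theorem hasSum_norm_sq_kernelCoord (f : PosRegularSeries n) {m : ℕ} (hm : 1 ≤ m)
    {T : Fin n → H →L[ℂ] H} (hT : T ∈ ncDomain f m H) (hpure : IsPure f T) (x : H) :
    HasSum (fun α => ‖kernelCoord f m T α x‖ ^ 2) (‖x‖ ^ 2) := by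
  refine hasSum_of_tsum_ofReal (fun _ => sq_nonneg _) (sq_nonneg _) ?_
  rw [← tsum_bCoeff_mul_defectPow f hm hT hpure x]
  refine tsum_congr fun α => ?_
  rw [← norm_defectOp_sq f m (hT.2 m hm le_rfl), ← ENNReal.ofReal_mul (bCoeff_pos f m α).le,
    kernelCoord, _root_.smul_apply, norm_smul, mul_pow, Complex.norm_real,
    Real.norm_of_nonneg (Real.sqrt_nonneg _), Real.sq_sqrt (bCoeff_pos f m α).le]
  rfl

theorem hasSum_kernelTerm (f : PosRegularSeries n) {m : ℕ} (hm : 1 ≤ m)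
    {T : Fin n → H →L[ℂ] H} (hT : T ∈ ncDomain f m H) (hpure : IsPure f T) (h : H) :
    HasSum (kernelTerm f m T h) (berezinKernel f m T h) := by
  have hK : ∃ K : H →L[ℂ] FockTensor n H, ∀ h, HasSum (kernelTerm f m T h) (K h) := by
    obtain ⟨V, hV⟩ := exists_columnOp (kernelCoord f m T) 1 fun x =>
      ⟨_, (one_mul _).ge, hasSum_norm_sq_kernelCoord f hm hT hpure x⟩
    exact ⟨V, fun h => (hV h).congr_fun (kernelTerm_eq f m T h)⟩
  rw [berezinKernel, dif_pos hK]
  exact hK.choose_spec h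

theorem hasSum_berezinKernel (f : PosRegularSeries n) {m : ℕ} (hm : 1 ≤ m)
    {T : Fin n → H →L[ℂ] H} (hT : T ∈ ncDomain f m H) (hpure : IsPure f T) (h : H) :
    HasSum (fun α => elemTensor (fockBasis α) (kernelCoord f m T α h)) (berezinKernel f m T h) :=
  (hasSum_kernelTerm f hm hT hpure h).congr_fun fun α => (kernelTerm_eq f m T h α).symm

theorem norm_berezinKernel_apply (f : PosRegularSeries n) {m : ℕ} (hm : 1 ≤ m)
    {T : Fin n → H →L[ℂ] H} (hT : T ∈ ncDomain f m H) (hpure : IsPure f T) (h : H) :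
    ‖berezinKernel f m T h‖ = ‖h‖ := by
  have h1 := hasSum_norm_sq_columnOp (hasSum_berezinKernel f hm hT hpure) h
  have h2 := h1.unique (hasSum_norm_sq_kernelCoord f hm hT hpure h)
  exact (sq_eq_sq₀ (norm_nonneg _) (norm_nonneg _)).1 h2

theorem norm_berezinKernel_le (f : PosRegularSeries n) {m : ℕ} (hm : 1 ≤ m)
    {T : Fin n → H →L[ℂ] H} (hT : T ∈ ncDomain f m H) (hpure : IsPure f T) :
    ‖berezinKernel f m T‖ ≤ 1 :=
  ContinuousLinearMap.opNorm_le_bound _ zero_le_one fun h => by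
    rw [norm_berezinKernel_apply f hm hT hpure, one_mul]

theorem adjoint_berezinKernel_comp_self (f : PosRegularSeries n) {m : ℕ} (hm : 1 ≤ m)
    {T : Fin n → H →L[ℂ] H} (hT : T ∈ ncDomain f m H) (hpure : IsPure f T) :
    adjoint (berezinKernel f m T) ∘L berezinKernel f m T = 1 :=
  (ContinuousLinearMap.norm_map_iff_adjoint_comp_self _).1
    (norm_berezinKernel_apply f hm hT hpure)

theorem adjoint_berezinKernel_elemTensor (f : PosRegularSeries n) {m : ℕ} (hm : 1 ≤ m)
    {T : Fin n → H →L[ℂ] H} (hT : T ∈ ncDomain f m H) (hpure : IsPure f T) (α : List (Fin n))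
    (h : H) :
    adjoint (berezinKernel f m T) (elemTensor (fockBasis α) h) =
      (√(bCoeff f m α) : ℂ) • wordOp T α (defectOp f m T h) := by
  rw [adjoint_columnOp (hasSum_berezinKernel f hm hT hpure), kernelCoord, map_smulₛₗ,
    adjoint_comp, adjoint_adjoint, (isSelfAdjoint_defectOp f m T).adjoint_eq]
  simp

/-- The intertwining relation `K* (W_α ⊗ I) = T_α K*` for a generator. -/
theorem adjoint_berezinKernel_comp_weightedShift (f : PosRegularSeries n) {m : ℕ} (hm : 1 ≤ m)
    {T : Fin n → H →L[ℂ] H} (hT : T ∈ ncDomain f m H) (hpure : IsPure f T) (i : Fin n) :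
    adjoint (berezinKernel f m T) ∘L ampl H (weightedShift f m i) =
      T i ∘L adjoint (berezinKernel f m T) := by
  refine ContinuousLinearMap.ext_on span_fockBasis_elemTensor_dense ?_
  rintro _ ⟨⟨α, h⟩, rfl⟩
  have hb : (√(bCoeff f m (i :: α)) : ℂ) ≠ 0 :=
    Complex.ofReal_ne_zero.2 (Real.sqrt_pos.2 (bCoeff_pos f m _)).ne'
  simp only [ContinuousLinearMap.comp_apply, ampl_elemTensor, weightedShift_basis,
    elemTensor_smul_left, map_smul, adjoint_berezinKernel_elemTensor f hm hT hpure, smul_smul]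
  have hw : wordOp T (i :: α) (defectOp f m T h) = T i (wordOp T α (defectOp f m T h)) := by
    simp [wordOp]
  rw [hw, shiftWeight, Complex.ofReal_div, div_mul_cancel₀ _ hb]

-- The relation for generators composes along the word, one letter at a time.
theorem adjoint_berezinKernel_comp_wordOp (f : PosRegularSeries n) {m : ℕ} (hm : 1 ≤ m)
    {T : Fin n → H →L[ℂ] H} (hT : T ∈ ncDomain f m H) (hpure : IsPure f T) (α : List (Fin n)) :
    adjoint (berezinKernel f m T) ∘L ampl H (wordOp (weightedShift f m) α) =
      wordOp T α ∘L adjoint (berezinKernel f m T) := by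
  induction α with
  | nil => simp [wordOp, ContinuousLinearMap.one_def, ampl_id]
  | cons i α ih =>
    have h1 : ∀ {K : Type _} [NormedAddCommGroup K] [InnerProductSpace ℂ K] (X : Fin n → K →L[ℂ] K),
        wordOp X (i :: α) = X i ∘L wordOp X α := by
      intro K _ _ X
      simp [wordOp, ContinuousLinearMap.mul_def]
    rw [h1, ampl_comp, ← ContinuousLinearMap.comp_assoc,
      adjoint_berezinKernel_comp_weightedShift f hm hT hpure, ContinuousLinearMap.comp_assoc, ih,
      ← ContinuousLinearMap.comp_assoc]
    simp [wordOp, ContinuousLinearMap.mul_def]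

end Kernel

/-! ### The Hardy algebra through matrix entries -/

section Hardy

variable {n : ℕ}

/-- The ratio `√b_α / √b_{βα}`, the weight of `W_β` at `e_α`. -/
def wordWeight (f : PosRegularSeries n) (m : ℕ) (β α : List (Fin n)) : ℂ :=
  (√(bCoeff f m α) : ℂ) / (√(bCoeff f m (β ++ α)) : ℂ)

theorem sqrt_bCoeff_ne_zero (f : PosRegularSeries n) (m : ℕ) (α : List (Fin n)) :
    (√(bCoeff f m α) : ℂ) ≠ 0 :=
  Complex.ofReal_ne_zero.2 (Real.sqrt_pos.2 (bCoeff_pos f m _)).ne'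

theorem wordOp_weightedShift_basis (f : PosRegularSeries n) (m : ℕ) (β α : List (Fin n)) :
    wordOp (weightedShift f m) β (fockBasis α) = wordWeight f m β α • fockBasis (β ++ α) := by
  induction β with
  | nil => simp [wordOp, wordWeight, div_self (sqrt_bCoeff_ne_zero f m α)]
  | cons i β ih =>
    have h : wordOp (weightedShift f m) (i :: β) (fockBasis α) =
        weightedShift f m i (wordOp (weightedShift f m) β (fockBasis α)) := by simp [wordOp]
    rw [h, ih, map_smul, weightedShift_basis, smul_smul, wordWeight, wordWeight, shiftWeight,
      Complex.ofReal_div, div_mul_div_cancel₀ (sqrt_bCoeff_ne_zero f m _), List.cons_append]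

theorem clm_ext_fockBasis {G : Type*} [NormedAddCommGroup G] [NormedSpace ℂ G]
    {A B : Fock n →L[ℂ] G} (h : ∀ α, A (fockBasis α) = B (fockBasis α)) : A = B :=
  ContinuousLinearMap.ext_on span_fockBasis_dense (by rintro _ ⟨α, rfl⟩; exact h α)

theorem hasSum_clm_apply_coord (g : Fock n →L[ℂ] Fock n) (x : Fock n) (ω : List (Fin n)) :
    HasSum (fun τ => x τ * g (fockBasis τ) ω) (g x ω) := by
  have h := (innerSL ℂ (fockBasis ω) ∘L g).hasSum (hasSum_fockBasis x)
  simpa [inner_fockBasis_left] using h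

theorem summable_norm_sq_coord (x : Fock n) : Summable fun α => ‖x α‖ ^ 2 := by
  simpa using (lp.memℓp x).summable (by simp)

/-- `g` has the Fourier representation `∑ c_β W_β` if and only if its matrix is
`⟨e_{βα}, g e_α⟩ = c_β √b_α / √b_{βα}`, the other entries being zero. -/
theorem hasFourierRep_iff (f : PosRegularSeries n) (m : ℕ) (g : Fock n →L[ℂ] Fock n)
    (c : List (Fin n) → ℂ) :
    HasFourierRep f m g c ↔
      (∀ α β, g (fockBasis α) (β ++ α) = c β * wordWeight f m β α) ∧
      ∀ α ω, ¬ α <:+ ω → g (fockBasis α) ω = 0 := by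
  have hinj : ∀ α : List (Fin n), Function.Injective fun β : List (Fin n) => β ++ α :=
    fun α => List.append_left_injective α
  constructor
  · rintro ⟨-, h⟩
    have key : ∀ α ω, HasSum (fun β => c β * wordWeight f m β α * if ω = β ++ α then 1 else 0)
        (g (fockBasis α) ω) := by
      intro α ω
      have h1 := (innerSL ℂ (fockBasis ω)).hasSum (h _ (Submodule.subset_span ⟨α, rfl⟩))
      simpa [wordOp_weightedShift_basis, inner_fockBasis_left, fockBasis_apply, mul_assoc] using h1
    refine ⟨fun α β => (key α _).unique ?_, fun α ω hω => (key α ω).unique ?_⟩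
    · simpa using hasSum_single
        (f := fun β' => c β' * wordWeight f m β' α * if β ++ α = β' ++ α then 1 else 0) β
        fun β' hβ' => by rw [if_neg (fun e => hβ' (hinj α e).symm), mul_zero]
    · convert! hasSum_zero using 1
      ext β
      rw [if_neg (by rintro rfl; exact hω (List.suffix_append β α)), mul_zero]
  · rintro ⟨h1, h2⟩
    refine ⟨?_, fun p hp => ?_⟩
    -- Since `b_∅ = 1`, the coordinates of `g e_∅` are `c_β / √b_β`, so square summability comes for
    -- free.
    · refine (summable_norm_sq_coord (g (fockBasis []))).congr fun β => ?_
      have := h1 [] β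
      rw [List.append_nil] at this
      rw [this, norm_mul, mul_pow, wordWeight, bCoeff_nil, List.append_nil, norm_div, div_pow,
        Complex.norm_real, Complex.norm_real, Real.norm_of_nonneg (Real.sqrt_nonneg _),
        Real.norm_of_nonneg (Real.sqrt_nonneg _), Real.sq_sqrt (bCoeff_pos f m β).le]
      simp [div_eq_mul_inv]
    · induction hp using Submodule.span_induction with
      | mem p hp =>
        obtain ⟨α, rfl⟩ := hp
        have h3 := ((hinj α).hasSum_iff fun ω hω => ?_).2 (hasSum_fockBasis (g (fockBasis α)))
        · refine h3.congr_fun fun β => ?_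
          rw [wordOp_weightedShift_basis, smul_smul, Function.comp_apply, h1]
        · rw [h2 α ω (fun ⟨β, hβ⟩ => hω ⟨β, hβ⟩), zero_smul]
      | zero => simp
      | add p q _ _ hp hq => simpa using hp.add hq
      | smul a p _ hp => simpa [smul_comm _ a] using hp.const_smul a

theorem HasFourierRep.mul {f : PosRegularSeries n} {m : ℕ} {g h : Fock n →L[ℂ] Fock n}
    {c d : List (Fin n) → ℂ} (hg : HasFourierRep f m g c) (hh : HasFourierRep f m h d) :
    ∃ e, HasFourierRep f m (g * h) e := by
  rw [hasFourierRep_iff] at hg hh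
  -- The column at `e_∅` determines the coefficients: its entry at `δ` has to be the coefficient
  -- divided by `√b_δ`.
  refine ⟨fun δ => (√(bCoeff f m δ) : ℂ) * (g * h) (fockBasis []) δ, ?_⟩
  rw [hasFourierRep_iff]
  constructor
  · intro α δ
    have h1 := hasSum_clm_apply_coord g (h (fockBasis α)) (δ ++ α)
    have h2 := ((List.append_left_injective α).hasSum_iff fun τ hτ => by
      rw [hh.2 α τ (fun ⟨β, hβ⟩ => hτ ⟨β, hβ⟩), zero_mul]).2 h1
    -- The entries of `g h` at `(δα, α)` and `(δ, ∅)` are sums over the same words `β`. The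
    -- intermediate weights cancel, and corresponding terms differ by the constant factor `√b_δ √b_α
    -- / √b_{δα}`.
    have h3 := (hasSum_clm_apply_coord g (h (fockBasis [])) δ).mul_left
      ((√(bCoeff f m δ) : ℂ) * wordWeight f m δ α)
    refine (h2.unique (h3.congr_fun fun β => ?_)).trans ?_
    · simp only [Function.comp_apply]
      have e1 := hh.1 [] β
      rw [List.append_nil] at e1
      rw [hh.1 α β, e1]
      by_cases hβ : β <:+ δ
      · obtain ⟨γ, rfl⟩ := hβ
        rw [List.append_assoc, hg.1, hg.1]
        simp only [wordWeight, bCoeff_nil, List.append_nil, List.append_assoc]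
        have n1 := sqrt_bCoeff_ne_zero f m (γ ++ (β ++ α))
        have n2 := sqrt_bCoeff_ne_zero f m (γ ++ β)
        have n3 := sqrt_bCoeff_ne_zero f m (β ++ α)
        have n4 := sqrt_bCoeff_ne_zero f m β
        field_simp
        simp
      · rw [hg.2 _ _ hβ, hg.2 _ _ (fun h' => hβ ((List.suffix_append_self_iff).1 h'))]
        simp
    · change _ * g (h (fockBasis [])) δ = _ * g (h (fockBasis [])) δ * _
      ring
  · intro α ω hω
    refine (hasSum_clm_apply_coord g (h (fockBasis α)) ω).unique ?_
    convert! hasSum_zero using 1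
    ext τ
    by_cases hτ : α <:+ τ
    · rw [hg.2 τ ω (fun h' => hω (hτ.trans h')), mul_zero]
    · rw [hh.2 α τ hτ, zero_mul]

theorem HasFourierRep.add {f : PosRegularSeries n} {m : ℕ} {g h : Fock n →L[ℂ] Fock n}
    {c d : List (Fin n) → ℂ} (hg : HasFourierRep f m g c) (hh : HasFourierRep f m h d) :
    HasFourierRep f m (g + h) (c + d) := by
  rw [hasFourierRep_iff] at *
  refine ⟨fun α β => ?_, fun α ω hω => ?_⟩
  · have : (g + h) (fockBasis α) (β ++ α) =
      g (fockBasis α) (β ++ α) + h (fockBasis α) (β ++ α) := rfl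
    rw [this, hg.1, hh.1, Pi.add_apply, add_mul]
  · have : (g + h) (fockBasis α) ω = g (fockBasis α) ω + h (fockBasis α) ω := rfl
    rw [this, hg.2 _ _ hω, hh.2 _ _ hω, add_zero]

theorem HasFourierRep.smul {f : PosRegularSeries n} {m : ℕ} {g : Fock n →L[ℂ] Fock n}
    {c : List (Fin n) → ℂ} (a : ℂ) (hg : HasFourierRep f m g c) :
    HasFourierRep f m (a • g) (a • c) := by
  rw [hasFourierRep_iff] at *
  refine ⟨fun α β => ?_, fun α ω hω => ?_⟩
  · have : (a • g) (fockBasis α) (β ++ α) = a * g (fockBasis α) (β ++ α) := rfl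
    rw [this, hg.1, Pi.smul_apply, smul_eq_mul, mul_assoc]
  · have : (a • g) (fockBasis α) ω = a * g (fockBasis α) ω := rfl
    rw [this, hg.2 _ _ hω, mul_zero]

theorem hasFourierRep_wordOp (f : PosRegularSeries n) (m : ℕ) (β : List (Fin n)) :
    HasFourierRep f m (wordOp (weightedShift f m) β) (Pi.single β 1) := by
  rw [hasFourierRep_iff]
  refine ⟨fun α γ => ?_, fun α ω hω => ?_⟩
  · rw [wordOp_weightedShift_basis]
    change _ * fockBasis (β ++ α) (γ ++ α) = _
    by_cases h : γ = β
    · subst h; simp [fockBasis_apply]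
    · simp [fockBasis_apply, h]
  · rw [wordOp_weightedShift_basis]
    change _ * fockBasis (β ++ α) ω = _
    rw [fockBasis_apply, if_neg (by rintro rfl; exact hω (List.suffix_append β α)), mul_zero]

/-- The Hardy algebra as a subalgebra of the bounded operators on the Fock space. -/
def hardyAlgebra (f : PosRegularSeries n) (m : ℕ) : Subalgebra ℂ (Fock n →L[ℂ] Fock n) where
  carrier := hardySet f m
  mul_mem' := fun ⟨_, hc⟩ ⟨_, hd⟩ => hc.mul hd
  add_mem' := fun ⟨_, hc⟩ ⟨_, hd⟩ => ⟨_, hc.add hd⟩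
  algebraMap_mem' := fun a => ⟨_, by
    rw [Algebra.algebraMap_eq_smul_one]
    exact (hasFourierRep_wordOp f m []).smul a⟩

end Hardy
-- Schur multipliers, homogeneous parts and dilations
section Schur

variable {n : ℕ} {L : Type*} [NormedAddCommGroup L] [InnerProductSpace ℂ L]

/-- The isometry `e_α ↦ e_α ⊗ u_α` attached to a family of unit vectors. -/
theorem exists_diagonalIsometry (u : List (Fin n) → L) (hu : ∀ α, ‖u α‖ = 1) :
    ∃ J : Fock n →L[ℂ] HilbertTensor (Fock n) L, ‖J‖ ≤ 1 ∧
      ∀ α, J (fockBasis α) = elemTensor (fockBasis α) (u α) := by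
  let A : List (Fin n) → Fock n →L[ℂ] L := fun α => (innerSL ℂ (fockBasis α)).smulRight (u α)
  have hA : ∀ α x, A α x = x α • u α := fun α x => by simp [A, inner_fockBasis_left]
  have hsum : ∀ x : Fock n, HasSum (fun α => ‖A α x‖ ^ 2) (‖x‖ ^ 2) := by
    intro x
    simpa [hA, norm_smul, hu] using lp.hasSum_norm (p := 2) (by simp) x
  obtain ⟨J, hJ⟩ := exists_columnOp A 1 fun x => ⟨_, (one_mul _).ge, hsum x⟩
  refine ⟨J, ContinuousLinearMap.opNorm_le_bound _ zero_le_one fun x => ?_, fun α => ?_⟩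
  · rw [one_mul]
    exact ((sq_eq_sq₀ (norm_nonneg _) (norm_nonneg _)).1
      ((hasSum_norm_sq_columnOp hJ x).unique (hsum x))).le
  · refine (hJ _).unique ?_
    have h := hasSum_single (f := fun β => elemTensor (fockBasis β) (A β (fockBasis α))) α
      fun β hβ => by
        rw [hA, fockBasis_apply, if_neg hβ, elemTensor_smul_right, zero_smul]
    simpa [hA, fockBasis_apply] using h

/-- Schur multiplication by a Gram matrix of unit vectors is contractive. -/
theorem exists_schurMultiplier [CompleteSpace L] (g : Fock n →L[ℂ] Fock n) (u v : List (Fin n) → L)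
    (hu : ∀ α, ‖u α‖ = 1) (hv : ∀ α, ‖v α‖ = 1) :
    ∃ g' : Fock n →L[ℂ] Fock n, ‖g'‖ ≤ ‖g‖ ∧
      ∀ α ω, g' (fockBasis α) ω = g (fockBasis α) ω * inner ℂ (u ω) (v α) := by
  obtain ⟨J, hJ, hJe⟩ := exists_diagonalIsometry u hu
  obtain ⟨J', hJ', hJe'⟩ := exists_diagonalIsometry v hv
  -- Compressing `g ⊗ I` by the isometries `e_ω ↦ e_ω ⊗ u_ω` and `e_α ↦ e_α ⊗ v_α` multiplies each
  -- entry by `⟨u_ω, v_α⟩`.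
  refine ⟨adjoint J ∘L ampl L g ∘L J', ?_, fun α ω => ?_⟩
  · have h1 : ‖adjoint J‖ ≤ 1 := by rwa [LinearIsometryEquiv.norm_map]
    calc _ ≤ ‖adjoint J‖ * (‖ampl L g‖ * ‖J'‖) :=
          (opNorm_comp_le _ _).trans (by gcongr; exact opNorm_comp_le _ _)
      _ ≤ 1 * (‖g‖ * 1) := by gcongr; exact norm_ampl_le g
      _ = ‖g‖ := by ring
  · rw [← inner_fockBasis_left, ContinuousLinearMap.comp_apply, ContinuousLinearMap.comp_apply,
      adjoint_inner_right, hJe, hJe', ampl_elemTensor, inner_elemTensor, inner_fockBasis_left]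

/-- Unit vectors `v_i` in `ℓ²` with `⟨v_{i+j}, v_i⟩ = r^j`. -/
def geomVec (r : ℝ) : ℕ → lp (fun _ : ℕ => ℂ) 2
  | 0 => lp.single 2 0 1
  | i + 1 => (r : ℂ) • geomVec r i + (√(1 - r ^ 2) : ℂ) • lp.single 2 (i + 1) (1 : ℂ)

theorem geomVec_apply_of_lt (r : ℝ) {i s : ℕ} (h : i < s) : (geomVec r i) s = 0 := by
  induction i with
  | zero => simp [geomVec, h.ne']
  | succ i ih =>
    change (r : ℂ) * (geomVec r i) s + (√(1 - r ^ 2) : ℂ) *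
      (lp.single 2 (i + 1) (1 : ℂ) : lp (fun _ : ℕ => ℂ) 2) s = 0
    rw [ih (by omega), lp.single_apply_ne _ _ _ h.ne', mul_zero, mul_zero, add_zero]

theorem inner_single_geomVec (r : ℝ) {i s : ℕ} (h : i < s) :
    inner ℂ (lp.single 2 s (1 : ℂ) : lp (fun _ : ℕ => ℂ) 2) (geomVec r i) = 0 := by
  rw [lp.inner_single_left, geomVec_apply_of_lt r h, inner_zero_right]

theorem norm_geomVec {r : ℝ} (hr : r ∈ Set.Ioo (0 : ℝ) 1) (i : ℕ) : ‖geomVec r i‖ = 1 := by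
  induction i with
  | zero => simp [geomVec, lp.norm_single]
  | succ i ih =>
    have h0 : 0 ≤ 1 - r ^ 2 := by nlinarith [hr.1, hr.2]
    have h1 : inner ℂ ((r : ℂ) • geomVec r i)
        ((√(1 - r ^ 2) : ℂ) • lp.single 2 (i + 1) (1 : ℂ)) = (0 : ℂ) := by
      rw [inner_smul_left, inner_smul_right, ← inner_conj_symm,
        inner_single_geomVec r (Nat.lt_succ_self i)]
      simp
    have h2 := norm_add_sq_eq_norm_sq_add_norm_sq_of_inner_eq_zero _ _ h1
    rw [norm_smul, norm_smul, ih, lp.norm_single (by simp), Complex.norm_real, Complex.norm_real,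
      Real.norm_of_nonneg hr.1.le, Real.norm_of_nonneg (Real.sqrt_nonneg _)] at h2
    have h3 := Real.mul_self_sqrt h0
    have h4 : ‖geomVec r (i + 1)‖ * ‖geomVec r (i + 1)‖ = 1 := by
      rw [geomVec, h2, norm_one]; nlinarith
    nlinarith [norm_nonneg (geomVec r (i + 1))]

/-- Each step of the recursion scales by `r` and adds a coordinate outside the support of `geomVec r
i`. This order of indices is enough, because the entries of a Hardy operator vanish unless `α` is a
suffix of `ω`. -/
theorem inner_geomVec {r : ℝ} (hr : r ∈ Set.Ioo (0 : ℝ) 1) (i j : ℕ) :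
    inner ℂ (geomVec r (j + i)) (geomVec r i) = (r : ℂ) ^ j := by
  induction j with
  | zero =>
    rw [zero_add, inner_self_eq_norm_sq_to_K, norm_geomVec hr]; simp
  | succ j ih =>
    rw [add_right_comm, geomVec, inner_add_left, inner_smul_left, inner_smul_left, ih,
      inner_single_geomVec r (by omega), Complex.conj_ofReal, mul_zero, add_zero, pow_succ']

/-- The homogeneous part of degree `k` of an operator with a Fourier representation is bounded by
the norm of the operator. -/
theorem norm_homogeneous_le {f : PosRegularSeries n} {m : ℕ} {g : Fock n →L[ℂ] Fock n}
    {c : List (Fin n) → ℂ} (hg : HasFourierRep f m g c) (k : ℕ) :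
    ‖∑ w : Fin k → Fin n, c (List.ofFn w) • wordOp (weightedShift f m) (List.ofFn w)‖ ≤ ‖g‖ := by
  rw [hasFourierRep_iff] at hg
  -- This Gram matrix is the indicator of `|ω| = k + |α|`, which selects the entries of degree `k`.
  obtain ⟨g', hle, hg'⟩ := exists_schurMultiplier g
    (fun ω => (lp.single 2 ω.length 1 : lp (fun _ : ℕ => ℂ) 2))
    (fun α => (lp.single 2 (k + α.length) 1 : lp (fun _ : ℕ => ℂ) 2))
    (fun α => by simp [lp.norm_single]) (fun α => by simp [lp.norm_single])
  refine le_of_eq_of_le (congrArg _ ?_) hle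
  refine clm_ext_fockBasis fun α => ?_
  ext ω
  have hL : (∑ w : Fin k → Fin n, c (List.ofFn w) •
      wordOp (weightedShift f m) (List.ofFn w)) (fockBasis α) ω =
      ∑ w : Fin k → Fin n, c (List.ofFn w) * (wordWeight f m (List.ofFn w) α *
        if ω = List.ofFn w ++ α then 1 else 0) := by
    rw [← inner_fockBasis_left, sum_apply, inner_sum]
    refine Finset.sum_congr rfl fun w _ => ?_
    rw [_root_.smul_apply, wordOp_weightedShift_basis, inner_smul_right, inner_smul_right,
      inner_fockBasis]
  rw [hL, hg', lp.inner_single_left, lp.single_apply]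
  by_cases hω : α <:+ ω
  · obtain ⟨β, rfl⟩ := hω
    by_cases hk : β.length = k
    · subst hk
      rw [Finset.sum_eq_single (fun i => β.get i)]
      · rw [List.ofFn_get, hg.1]
        simp
      · intro w _ hw
        rw [if_neg, mul_zero, mul_zero]
        intro e
        apply hw
        have e' := List.append_left_injective α e
        apply List.ofFn_injective
        rw [List.ofFn_get]; exact e'.symm
      · simp
    · rw [Finset.sum_eq_zero]
      · simp [hk]
      · intro w _
        rw [if_neg, mul_zero, mul_zero]
        intro e
        apply hk
        have e' := List.append_left_injective α e
        rw [show β = List.ofFn w from e', List.length_ofFn]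
  · rw [hg.2 α ω hω, zero_mul]
    refine Finset.sum_eq_zero fun w _ => ?_
    rw [if_neg (by rintro rfl; exact hω (List.suffix_append _ α)), mul_zero, mul_zero]

/-- The dilation `g_r = ∑ c_β r^{|β|} W_β` of an operator with a Fourier representation. -/
theorem exists_dilation {f : PosRegularSeries n} {m : ℕ} {g : Fock n →L[ℂ] Fock n}
    {c : List (Fin n) → ℂ} (hg : HasFourierRep f m g c) {r : ℝ} (hr : r ∈ Set.Ioo (0 : ℝ) 1) :
    ∃ g' : Fock n →L[ℂ] Fock n, ‖g'‖ ≤ ‖g‖ ∧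
      HasFourierRep f m g' (fun β => (r : ℂ) ^ β.length * c β) := by
  rw [hasFourierRep_iff] at hg
  -- On words `ω = βα` this Gram matrix has the entry `r^{|β|}`.
  obtain ⟨g', hle, hg'⟩ := exists_schurMultiplier g
    (fun ω => geomVec r ω.length) (fun α => geomVec r α.length)
    (fun α => norm_geomVec hr _) (fun α => norm_geomVec hr _)
  refine ⟨g', hle, ?_⟩
  rw [hasFourierRep_iff]
  refine ⟨fun α β => ?_, fun α ω hω => by rw [hg', hg.2 α ω hω, zero_mul]⟩
  rw [hg', hg.1, List.length_append, inner_geomVec hr]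
  ring

theorem wordOp_smul {H : Type*} [NormedAddCommGroup H] [InnerProductSpace ℂ H] (r : ℂ)
    (X : Fin n → H →L[ℂ] H) (α : List (Fin n)) :
    wordOp (fun i => r • X i) α = r ^ α.length • wordOp X α := by
  induction α with
  | nil => simp [wordOp]
  | cons i α ih =>
    simp only [wordOp, List.map_cons, List.prod_cons, List.length_cons] at ih ⊢
    rw [ih, smul_mul_smul_comm, pow_succ']

theorem ncPartialSum_smul {H : Type*} [NormedAddCommGroup H] [InnerProductSpace ℂ H]
    (c : List (Fin n) → ℂ) (r : ℂ) (X : Fin n → H →L[ℂ] H) :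
    ncPartialSum c (fun i => r • X i) = ncPartialSum (fun β => r ^ β.length * c β) X := by
  ext1 N
  refine Finset.sum_congr rfl fun k _ => Finset.sum_congr rfl fun w _ => ?_
  rw [wordOp_smul, smul_smul, mul_comm]

theorem HasFourierRep.tendsto_ncPartialSum_basis {f : PosRegularSeries n} {m : ℕ}
    {g : Fock n →L[ℂ] Fock n} {c : List (Fin n) → ℂ} (hg : HasFourierRep f m g c)
    (α : List (Fin n)) :
    Tendsto (fun N => ncPartialSum c (weightedShift f m) N (fockBasis α)) atTop
      (𝓝 (g (fockBasis α))) := by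
  have h1 := hg.2 _ (Submodule.subset_span ⟨α, rfl⟩)
  have h2 := ((List.equivSigmaTuple (α := Fin n)).symm.hasSum_iff.2 h1).sigma
    fun k => hasSum_fintype _
  refine h2.tendsto_sum_nat.congr fun N => ?_
  simp [ncPartialSum, sum_apply, List.equivSigmaTuple]

/-- The partial sums of `∑ c_β r^{|β|} W_β` converge in norm to the dilation. -/
theorem tendsto_ncPartialSum_weightedShift {f : PosRegularSeries n} {m : ℕ}
    {g g' : Fock n →L[ℂ] Fock n} {c : List (Fin n) → ℂ} (hg : HasFourierRep f m g c) {r : ℝ}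
    (hr : r ∈ Set.Ioo (0 : ℝ) 1)
    (hg' : HasFourierRep f m g' (fun β => (r : ℂ) ^ β.length * c β)) :
    Tendsto (ncPartialSum (fun β => (r : ℂ) ^ β.length * c β) (weightedShift f m)) atTop
      (𝓝 g') := by
  -- The degree `k` part is `r^k` times the homogeneous part of `g`, hence dominated by `r^k ‖g‖`.
  have hs : Summable fun k : ℕ => ∑ w : Fin k → Fin n, ((r : ℂ) ^ (List.ofFn w).length *
      c (List.ofFn w)) • wordOp (weightedShift f m) (List.ofFn w) := by
    refine Summable.of_norm_bounded
      ((summable_geometric_of_lt_one hr.1.le hr.2).mul_right ‖g‖) fun k => ?_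
    have e : ∑ w : Fin k → Fin n, ((r : ℂ) ^ (List.ofFn w).length *
        c (List.ofFn w)) • wordOp (weightedShift f m) (List.ofFn w) = (r : ℂ) ^ k •
        ∑ w : Fin k → Fin n, c (List.ofFn w) • wordOp (weightedShift f m) (List.ofFn w) := by
      simp only [List.length_ofFn, Finset.smul_sum, smul_smul]
    rw [e, norm_smul, norm_pow, Complex.norm_real, Real.norm_of_nonneg hr.1.le]
    exact mul_le_mul_of_nonneg_left (norm_homogeneous_le hg k) (pow_nonneg hr.1.le k)
  obtain ⟨G, hG⟩ := hs
  have h1 : Tendsto (ncPartialSum (fun β => (r : ℂ) ^ β.length * c β) (weightedShift f m)) atTop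
      (𝓝 G) := hG.tendsto_sum_nat
  have h2 : G = g' := clm_ext_fockBasis fun α =>
    tendsto_nhds_unique (((ContinuousLinearMap.apply ℂ (Fock n)
      (fockBasis α)).continuous.tendsto G).comp h1) (hg'.tendsto_ncPartialSum_basis α)
  rwa [← h2]

/-- Dominated convergence applied to `‖z_r - y‖² = ∑ (1 - r^{d ω})² |y_ω|²`, with the summable
majorant `|y_ω|²`. -/
theorem tendsto_of_coord_eq_pow_mul {y : Fock n} {z : ℝ → Fock n} (d : List (Fin n) → ℕ)
    (hz : ∀ r ∈ Set.Ioo (0 : ℝ) 1, ∀ ω, z r ω = (r : ℂ) ^ d ω * y ω) :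
    Tendsto z (𝓝[<] 1) (𝓝 y) := by
  have hmem : ∀ᶠ r : ℝ in 𝓝[<] 1, r ∈ Set.Ioo (0 : ℝ) 1 := Ioo_mem_nhdsLT one_pos
  have hlim : Tendsto (fun r : ℝ => ∑' ω, (1 - r ^ d ω) ^ 2 * ‖y ω‖ ^ 2) (𝓝[<] 1)
      (𝓝 (∑' _ : List (Fin n), (0 : ℝ))) := by
    refine tendsto_tsum_of_dominated_convergence (summable_norm_sq_coord y) (fun ω => ?_) ?_
    · have : Continuous fun r : ℝ => (1 - r ^ d ω) ^ 2 * ‖y ω‖ ^ 2 := by fun_prop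
      simpa using (this.tendsto 1).mono_left nhdsWithin_le_nhds
    · filter_upwards [hmem] with r hr ω
      have h0 := pow_nonneg hr.1.le (d ω)
      have h1 := pow_le_one₀ hr.1.le hr.2.le (n := d ω)
      rw [Real.norm_of_nonneg (by positivity)]
      exact mul_le_of_le_one_left (sq_nonneg _) (pow_le_one₀ (by linarith) (by linarith))
  rw [tendsto_iff_norm_sub_tendsto_zero]
  have hsq : Tendsto (fun r => ‖z r - y‖ ^ 2) (𝓝[<] 1) (𝓝 0) := by
    rw [tsum_zero] at hlim
    refine hlim.congr' ?_
    filter_upwards [hmem] with r hr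
    have hx : HasSum (fun ω => ‖(z r - y) ω‖ ^ 2) (‖z r - y‖ ^ 2) := by
      simpa using lp.hasSum_norm (p := 2) (by simp) (z r - y)
    rw [← hx.tsum_eq]
    refine tsum_congr fun ω => ?_
    have e : (z r - y) ω = ((r ^ d ω - 1 : ℝ) : ℂ) * y ω := by
      change z r ω - y ω = _
      rw [hz r hr]; push_cast; ring
    rw [e, norm_mul, mul_pow, Complex.norm_real, Real.norm_eq_abs, sq_abs]
    ring
  simpa using (Real.continuous_sqrt.tendsto 0).comp hsq |>.congr fun r => by
    simp [Real.sqrt_sq (norm_nonneg _)]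

/-- The dilations converge to the operator on the basis vectors as `r → 1`. -/
theorem tendsto_dilation_basis {f : PosRegularSeries n} {m : ℕ} {g : Fock n →L[ℂ] Fock n}
    {c : List (Fin n) → ℂ} (hg : HasFourierRep f m g c) {D : ℝ → Fock n →L[ℂ] Fock n}
    (hD : ∀ r ∈ Set.Ioo (0 : ℝ) 1,
      HasFourierRep f m (D r) (fun β => (r : ℂ) ^ β.length * c β)) (α : List (Fin n)) :
    Tendsto (fun r => D r (fockBasis α)) (𝓝[<] 1) (𝓝 (g (fockBasis α))) := by
  -- Truncation of the subtraction is harmless: if `α` is not a suffix of `ω`, both coordinates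
  -- vanish.
  refine tendsto_of_coord_eq_pow_mul (fun ω => ω.length - α.length) fun r hr ω => ?_
  have h1 := (hasFourierRep_iff f m g c).1 hg
  have h2 := (hasFourierRep_iff f m (D r) _).1 (hD r hr)
  by_cases hω : α <:+ ω
  · obtain ⟨β, rfl⟩ := hω
    rw [h1.1, h2.1, List.length_append, Nat.add_sub_cancel, mul_assoc]
  · rw [h1.2 _ _ hω, h2.2 _ _ hω, mul_zero]

end Schur
-- The Berezin transform on the Hardy algebra
section Transform

variable {n : ℕ} {H : Type*} [NormedAddCommGroup H] [InnerProductSpace ℂ H]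

theorem tendsto_ampl_apply {ι : Type*} {l : Filter ι} {g : ι → Fock n →L[ℂ] Fock n}
    {g₀ : Fock n →L[ℂ] Fock n} {C : ℝ} (hC : ∀ᶠ i in l, ‖g i‖ ≤ C)
    (h : ∀ α, Tendsto (fun i => g i (fockBasis α)) l (𝓝 (g₀ (fockBasis α))))
    (ξ : HilbertTensor (Fock n) H) :
    Tendsto (fun i => ampl H (g i) ξ) l (𝓝 (ampl H g₀ ξ)) := by
  refine tendsto_apply_of_dense_span (hC.mono fun i hi => (norm_ampl_le (g i)).trans hi)
    span_fockBasis_elemTensor_dense ?_ ξ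
  rintro _ ⟨⟨α, k⟩, rfl⟩
  simp only [ampl_elemTensor]
  exact ((continuous_elemTensor_left k).tendsto _).comp (h α)

/-- Two density arguments, one in `ξ` and one in `η`, each using the uniform norm bound. Conjugation
moves the second variable to the slot where the inner product is linear. -/
theorem tendsto_inner_ampl_apply {ι : Type*} {l : Filter ι} {g : ι → Fock n →L[ℂ] Fock n}
    {g₀ : Fock n →L[ℂ] Fock n} {C : ℝ} (hC : ∀ᶠ i in l, ‖g i‖ ≤ C)
    (h : ∀ x y, Tendsto (fun i => (inner ℂ y (g i x) : ℂ)) l (𝓝 (inner ℂ y (g₀ x))))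
    (ξ η : HilbertTensor (Fock n) H) :
    Tendsto (fun i => (inner ℂ η (ampl H (g i) ξ) : ℂ)) l (𝓝 (inner ℂ η (ampl H g₀ ξ))) := by
  have h1 : ∀ (y : Fock n) (k : H) (ξ : HilbertTensor (Fock n) H),
      Tendsto (fun i => (inner ℂ (elemTensor y k) (ampl H (g i) ξ) : ℂ)) l
        (𝓝 (inner ℂ (elemTensor y k) (ampl H g₀ ξ))) := by
    intro y k ξ
    refine tendsto_apply_of_dense_span
      (B := fun i => innerSL ℂ (elemTensor y k) ∘L ampl H (g i))
      (B₀ := innerSL ℂ (elemTensor y k) ∘L ampl H g₀) (C := ‖elemTensor y k‖ * C)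
      (hC.mono fun i hi => ?_) span_elemTensor_dense ?_ ξ
    · refine (opNorm_comp_le _ _).trans ?_
      rw [innerSL_apply_norm]
      exact mul_le_mul_of_nonneg_left ((norm_ampl_le (g i)).trans hi) (norm_nonneg _)
    · rintro _ ⟨⟨x, k'⟩, rfl⟩
      simpa [inner_elemTensor] using (h x y).mul_const (inner ℂ k k')
  have h2 : Tendsto (fun i => (inner ℂ (ampl H (g i) ξ) η : ℂ)) l
      (𝓝 (inner ℂ (ampl H g₀ ξ) η)) := by
    refine tendsto_apply_of_dense_span (B := fun i => innerSL ℂ (ampl H (g i) ξ))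
      (B₀ := innerSL ℂ (ampl H g₀ ξ)) (C := C * ‖ξ‖)
      (hC.mono fun i hi => ?_) span_elemTensor_dense ?_ η
    · rw [innerSL_apply_norm]
      exact (ampl H (g i)).le_of_opNorm_le ((norm_ampl_le (g i)).trans hi) ξ
    · rintro _ ⟨⟨y, k⟩, rfl⟩
      simpa [Function.comp_def] using (Complex.continuous_conj.tendsto _).comp (h1 y k ξ)
  simpa [Function.comp_def] using (Complex.continuous_conj.tendsto _).comp h2

/-- The relation `∑ p_i* p_i = I` for the coordinate projections survives ampliation. This replaces
an explicit identification of `F²(H_n)^(k) ⊗ H` with `(F²(H_n) ⊗ H)^(k)`. -/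
theorem norm_sum_ampl_proj_sq {k : ℕ} (ζ : HilbertTensor (PiLp 2 fun _ : Fin k => Fock n) H) :
    ∑ i, ‖ampl H (PiLp.proj 2 (fun _ : Fin k => Fock n) i : _ →L[ℂ] Fock n) ζ‖ ^ 2 = ‖ζ‖ ^ 2 := by
  have h1 : ∑ i, adjoint (PiLp.proj 2 (fun _ : Fin k => Fock n) i : _ →L[ℂ] Fock n) ∘L
      (PiLp.proj 2 (fun _ : Fin k => Fock n) i : _ →L[ℂ] Fock n) = .id ℂ _ := by
    ext1 x
    refine ext_inner_left ℂ fun y => ?_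
    simp [sum_apply, inner_sum, adjoint_inner_right, PiLp.inner_apply]
  have h2 : ∀ i, ‖ampl H (PiLp.proj 2 (fun _ : Fin k => Fock n) i : _ →L[ℂ] Fock n) ζ‖ ^ 2 =
      (inner ℂ ζ (ampl H (adjoint (PiLp.proj 2 (fun _ : Fin k => Fock n) i : _ →L[ℂ] Fock n) ∘L
      (PiLp.proj 2 (fun _ : Fin k => Fock n) i : _ →L[ℂ] Fock n)) ζ)).re := by
    intro i
    rw [ampl_comp, ContinuousLinearMap.comp_apply, ← inner_ampl_left, ← RCLike.re_eq_complex_re,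
      inner_self_eq_norm_sq]
  simp only [h2]
  rw [← Complex.re_sum, ← inner_sum, ← sum_apply, ← ampl_sum, h1, ampl_id,
    ContinuousLinearMap.id_apply, ← RCLike.re_eq_complex_re, inner_self_eq_norm_sq]

theorem matrixOp_apply {k : ℕ} (A : Matrix (Fin k) (Fin k) (H →L[ℂ] H))
    (y : PiLp 2 fun _ : Fin k => H) (i : Fin k) : matrixOp A y i = ∑ j, A i j (y j) := by
  simp [matrixOp, sum_apply]

/-- `‖[x_ij ⊗ I]‖ ≤ ‖[x_ij]‖`. -/
theorem sum_norm_sq_ampl_le {k : ℕ} (x : Matrix (Fin k) (Fin k) (Fock n →L[ℂ] Fock n))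
    (ξ : Fin k → HilbertTensor (Fock n) H) :
    ∑ i, ‖∑ j, ampl H (x i j) (ξ j)‖ ^ 2 ≤ ‖matrixOp x‖ ^ 2 * ∑ j, ‖ξ j‖ ^ 2 := by
  let p : Fin k → (PiLp 2 fun _ : Fin k => Fock n) →L[ℂ] Fock n := PiLp.proj 2 _
  let e : Fin k → Fock n →L[ℂ] (PiLp 2 fun _ : Fin k => Fock n) := fun j =>
    (PiLp.continuousLinearEquiv 2 ℂ (fun _ : Fin k => Fock n)).symm.toContinuousLinearMap ∘L
      ContinuousLinearMap.single ℂ (fun _ : Fin k => Fock n) j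
  have hpe : ∀ i j, p i ∘L e j = if i = j then .id ℂ _ else 0 := by
    intro i j
    ext1 u
    by_cases h : i = j
    · subst h; simp [p, e]
    · simp [p, e, h]
  -- `ζ` packs the family `ξ` into one vector, on which the matrix acts as the single ampliation
  -- `matrixOp x ⊗ I`.
  let ζ := ∑ j, ampl H (e j) (ξ j)
  have h1 : ∀ i, ampl H (p i) ζ = ξ i := by
    intro i
    simp only [ζ, map_sum, ← ContinuousLinearMap.comp_apply, ← ampl_comp, hpe]
    rw [Finset.sum_eq_single i]
    · simp [ampl_id]
    · intro j _ hj
      rw [if_neg hj.symm, ampl_zero]; rfl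
    · simp
  have h2 : ∀ i, ampl H (p i) (ampl H (matrixOp x) ζ) = ∑ j, ampl H (x i j) (ξ j) := by
    intro i
    have : p i ∘L matrixOp x = ∑ j, x i j ∘L p j := by
      ext1 u
      rw [sum_apply]
      exact matrixOp_apply x u i
    rw [← ContinuousLinearMap.comp_apply, ← ampl_comp, this, ampl_sum, sum_apply]
    refine Finset.sum_congr rfl fun j _ => ?_
    rw [ampl_comp, ContinuousLinearMap.comp_apply, h1]
  calc ∑ i, ‖∑ j, ampl H (x i j) (ξ j)‖ ^ 2 = ‖ampl H (matrixOp x) ζ‖ ^ 2 := by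
        simp only [← h2]; exact norm_sum_ampl_proj_sq _
    _ ≤ (‖matrixOp x‖ * ‖ζ‖) ^ 2 := by
        gcongr; exact (ampl H (matrixOp x)).le_of_opNorm_le (norm_ampl_le _) ζ
    _ = ‖matrixOp x‖ ^ 2 * ∑ j, ‖ξ j‖ ^ 2 := by
        rw [mul_pow]; congr 1
        simp only [← h1]; exact (norm_sum_ampl_proj_sq ζ).symm

theorem continuous_ampl : Continuous fun g : Fock n →L[ℂ] Fock n => ampl H g := by
  suffices h : LipschitzWith 1 fun g : Fock n →L[ℂ] Fock n => ampl H g from h.continuous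
  refine LipschitzWith.of_dist_le_mul fun g h => ?_
  have e : ampl H g - ampl H h = ampl H (g - h) := by
    rw [sub_eq_iff_eq_add, ← ampl_add, sub_add_cancel]
  rw [dist_eq_norm, dist_eq_norm, e, NNReal.coe_one, one_mul]
  exact norm_ampl_le _

theorem tendsto_nhds_wot_iff [CompleteSpace H] {ι : Type*} {l : Filter ι} {F : ι → H →L[ℂ] H}
    {A : H →L[ℂ] H} :
    Tendsto F l (@nhds _ (wot H) A) ↔
      ∀ x y, Tendsto (fun i => (inner ℂ y (F i x) : ℂ)) l (𝓝 (inner ℂ y (A x))) := by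
  rw [nhds_induced, tendsto_comap_iff,
    ContinuousLinearMapWOT.tendsto_iff_forall_inner_apply_tendsto]
  rfl

theorem tendsto_nhds_sot_iff {ι : Type*} {l : Filter ι} {F : ι → H →L[ℂ] H}
    {A : H →L[ℂ] H} :
    Tendsto F l (@nhds _ (sot H) A) ↔ ∀ x, Tendsto (fun i => F i x) l (𝓝 (A x)) := by
  rw [nhds_induced, tendsto_comap_iff, PointwiseConvergenceCLM.tendsto_iff_forall_tendsto]
  rfl

/-- The dilations of an operator in the Hardy algebra, bounded by its norm. -/
theorem exists_dilations {f : PosRegularSeries n} {m : ℕ} {g : Fock n →L[ℂ] Fock n}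
    {c : List (Fin n) → ℂ} (hg : HasFourierRep f m g c) :
    ∃ D : ℝ → Fock n →L[ℂ] Fock n, ∀ r ∈ Set.Ioo (0 : ℝ) 1, ‖D r‖ ≤ ‖g‖ ∧
      HasFourierRep f m (D r) (fun β => (r : ℂ) ^ β.length * c β) := by
  choose! D hD using fun (r : ℝ) (hr : r ∈ Set.Ioo (0 : ℝ) 1) => exists_dilation hg hr
  exact ⟨D, hD⟩

theorem tendsto_ampl_dilation {f : PosRegularSeries n} {m : ℕ} {g : Fock n →L[ℂ] Fock n}
    {c : List (Fin n) → ℂ} (hg : HasFourierRep f m g c) {D : ℝ → Fock n →L[ℂ] Fock n}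
    (hD : ∀ r ∈ Set.Ioo (0 : ℝ) 1, ‖D r‖ ≤ ‖g‖ ∧
      HasFourierRep f m (D r) (fun β => (r : ℂ) ^ β.length * c β))
    (ξ : HilbertTensor (Fock n) H) :
    Tendsto (fun r => ampl H (D r) ξ) (𝓝[<] 1) (𝓝 (ampl H g ξ)) :=
  tendsto_ampl_apply (C := ‖g‖)
    (Filter.mem_of_superset (Ioo_mem_nhdsLT one_pos) fun r hr => (hD r hr).1)
    (tendsto_dilation_basis hg fun r hr => (hD r hr).2) ξ

variable [CompleteSpace H]

theorem berezinTransform_eq (f : PosRegularSeries n) (m : ℕ) (T : Fin n → H →L[ℂ] H)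
    (g : Fock n →L[ℂ] Fock n) :
    berezinTransform f m T g =
      adjoint (berezinKernel f m T) ∘L ampl H g ∘L berezinKernel f m T := rfl

/-- The Berezin transform as a linear map. -/
def berezinLinear (f : PosRegularSeries n) (m : ℕ) (T : Fin n → H →L[ℂ] H) :
    (Fock n →L[ℂ] Fock n) →ₗ[ℂ] (H →L[ℂ] H) where
  toFun := berezinTransform f m T
  map_add' g h := by
    simp only [berezinTransform_eq, ampl_add, ContinuousLinearMap.add_comp,
      ContinuousLinearMap.comp_add]
  map_smul' a g := by
    simp only [berezinTransform_eq, ampl_smul, ContinuousLinearMap.smul_comp,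
      ContinuousLinearMap.comp_smul, RingHom.id_apply]

theorem continuous_berezinTransform (f : PosRegularSeries n) (m : ℕ) (T : Fin n → H →L[ℂ] H) :
    Continuous (berezinTransform f m T) :=
  continuous_const.clm_comp (continuous_ampl.clm_comp continuous_const)

theorem continuousOn_wot_berezinTransform (f : PosRegularSeries n) (m : ℕ)
    (T : Fin n → H →L[ℂ] H) {S : Set (Fock n →L[ℂ] Fock n)} (hS : Bornology.IsBounded S) :
    @ContinuousOn _ _ (wot (Fock n)) (wot H) (berezinTransform f m T) S := by
  obtain ⟨C, hC⟩ := hS.exists_norm_le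
  intro g₀ hg₀
  have h1 : ∀ᶠ g in @nhdsWithin _ (wot (Fock n)) g₀ S, ‖g‖ ≤ C :=
    (@eventually_mem_nhdsWithin _ (wot (Fock n)) g₀ S).mono hC
  have h2 := tendsto_nhds_wot_iff.1 (tendsto_id'.2
    (@nhdsWithin_le_nhds _ (wot (Fock n)) g₀ S))
  refine tendsto_nhds_wot_iff.2 fun x y => ?_
  simpa only [berezinTransform_eq, ContinuousLinearMap.comp_apply, adjoint_inner_right] using
    tendsto_inner_ampl_apply h1 h2 (berezinKernel f m T x) (berezinKernel f m T y)

theorem continuousOn_sot_berezinTransform (f : PosRegularSeries n) (m : ℕ)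
    (T : Fin n → H →L[ℂ] H) {S : Set (Fock n →L[ℂ] Fock n)} (hS : Bornology.IsBounded S) :
    @ContinuousOn _ _ (sot (Fock n)) (sot H) (berezinTransform f m T) S := by
  obtain ⟨C, hC⟩ := hS.exists_norm_le
  intro g₀ hg₀
  have h1 : ∀ᶠ g in @nhdsWithin _ (sot (Fock n)) g₀ S, ‖g‖ ≤ C :=
    (@eventually_mem_nhdsWithin _ (sot (Fock n)) g₀ S).mono hC
  have h2 := tendsto_nhds_sot_iff.1 (tendsto_id'.2
    (@nhdsWithin_le_nhds _ (sot (Fock n)) g₀ S))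
  refine tendsto_nhds_sot_iff.2 fun x => ?_
  exact ((adjoint (berezinKernel f m T)).continuous.tendsto _).comp
    (tendsto_ampl_apply h1 (fun α => h2 (fockBasis α)) (berezinKernel f m T x))

theorem adjoint_berezinKernel_comp_ncPartialSum (f : PosRegularSeries n) {m : ℕ} (hm : 1 ≤ m)
    {T : Fin n → H →L[ℂ] H} (hT : T ∈ ncDomain f m H) (hpure : IsPure f T)
    (c : List (Fin n) → ℂ) (N : ℕ) :
    adjoint (berezinKernel f m T) ∘L ampl H (ncPartialSum c (weightedShift f m) N) =
      ncPartialSum c T N ∘L adjoint (berezinKernel f m T) := by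
  simp only [ncPartialSum, ampl_sum, ampl_smul, ContinuousLinearMap.comp_finsetSum,
    ContinuousLinearMap.finsetSum_comp, ContinuousLinearMap.comp_smul,
    ContinuousLinearMap.smul_comp, adjoint_berezinKernel_comp_wordOp f hm hT hpure]

/-- Composing the intertwining relation with `K` on the right and using `K* K = I` identifies the
transform. -/
theorem berezinTransform_of_intertwine (f : PosRegularSeries n) {m : ℕ} (hm : 1 ≤ m)
    {T : Fin n → H →L[ℂ] H} (hT : T ∈ ncDomain f m H) (hpure : IsPure f T)
    {g : Fock n →L[ℂ] Fock n} {A : H →L[ℂ] H}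
    (h : adjoint (berezinKernel f m T) ∘L ampl H g = A ∘L adjoint (berezinKernel f m T)) :
    berezinTransform f m T g = A := by
  rw [berezinTransform_eq, ← ContinuousLinearMap.comp_assoc, h, ContinuousLinearMap.comp_assoc,
    adjoint_berezinKernel_comp_self f hm hT hpure]
  rfl

theorem tendsto_ncPartialSum_dilation (f : PosRegularSeries n) {m : ℕ} (hm : 1 ≤ m)
    {T : Fin n → H →L[ℂ] H} (hT : T ∈ ncDomain f m H) (hpure : IsPure f T)
    {g g' : Fock n →L[ℂ] Fock n} {c : List (Fin n) → ℂ} (hg : HasFourierRep f m g c) {r : ℝ}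
    (hr : r ∈ Set.Ioo (0 : ℝ) 1)
    (hg' : HasFourierRep f m g' (fun β => (r : ℂ) ^ β.length * c β)) :
    Tendsto (ncPartialSum c (fun i => (r : ℂ) • T i)) atTop (𝓝 (berezinTransform f m T g')) := by
  rw [ncPartialSum_smul]
  refine (((continuous_berezinTransform f m T).tendsto g').comp
    (tendsto_ncPartialSum_weightedShift hg hr hg')).congr fun N => ?_
  exact berezinTransform_of_intertwine f hm hT hpure
    (adjoint_berezinKernel_comp_ncPartialSum f hm hT hpure _ N)

theorem tendsto_berezinTransform_dilation (T : Fin n → H →L[ℂ] H) {f : PosRegularSeries n}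
    {m : ℕ} {g : Fock n →L[ℂ] Fock n}
    {c : List (Fin n) → ℂ} (hg : HasFourierRep f m g c) {D : ℝ → Fock n →L[ℂ] Fock n}
    (hD : ∀ r ∈ Set.Ioo (0 : ℝ) 1, ‖D r‖ ≤ ‖g‖ ∧
      HasFourierRep f m (D r) (fun β => (r : ℂ) ^ β.length * c β)) (x : H) :
    Tendsto (fun r => berezinTransform f m T (D r) x) (𝓝[<] 1)
      (𝓝 (berezinTransform f m T g x)) :=
  ((adjoint (berezinKernel f m T)).continuous.tendsto _).comp
    (tendsto_ampl_dilation hg hD (berezinKernel f m T x))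

/-- For `g` in the Hardy algebra, `K* (g ⊗ I) = Ψ(g) K*`. -/
theorem adjoint_berezinKernel_comp_ampl {f : PosRegularSeries n} {m : ℕ} (hm : 1 ≤ m)
    {T : Fin n → H →L[ℂ] H} (hT : T ∈ ncDomain f m H) (hpure : IsPure f T)
    {g : Fock n →L[ℂ] Fock n} {c : List (Fin n) → ℂ} (hg : HasFourierRep f m g c) :
    adjoint (berezinKernel f m T) ∘L ampl H g =
      berezinTransform f m T g ∘L adjoint (berezinKernel f m T) := by
  obtain ⟨D, hD⟩ := exists_dilations hg
  -- For fixed `r` the polynomial partial sums converge in norm, so their intertwining relation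
  -- passes to the dilation. The limit `r → 1` is only strong and is taken vector by vector
  -- afterwards.
  have h1 : ∀ r ∈ Set.Ioo (0 : ℝ) 1, adjoint (berezinKernel f m T) ∘L ampl H (D r) =
      berezinTransform f m T (D r) ∘L adjoint (berezinKernel f m T) := by
    intro r hr
    have hlim := tendsto_ncPartialSum_weightedShift hg hr (hD r hr).2
    have hamp := ((continuous_ampl (n := n) (H := H)).tendsto _).comp hlim
    have hT' := tendsto_ncPartialSum_dilation f hm hT hpure hg hr (hD r hr).2
    rw [ncPartialSum_smul] at hT'
    have h2 : Tendsto (fun N => adjoint (berezinKernel f m T) ∘L ampl H (ncPartialSum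
        (fun β => (r : ℂ) ^ β.length * c β) (weightedShift f m) N)) atTop
        (𝓝 (adjoint (berezinKernel f m T) ∘L ampl H (D r))) :=
      ((continuous_const.clm_comp continuous_id).tendsto (ampl H (D r))).comp hamp
    have h3 : Tendsto (fun N => ncPartialSum (fun β => (r : ℂ) ^ β.length * c β) T N ∘L
        adjoint (berezinKernel f m T)) atTop
        (𝓝 (berezinTransform f m T (D r) ∘L adjoint (berezinKernel f m T))) :=
      ((continuous_id.clm_comp continuous_const).tendsto (berezinTransform f m T (D r))).comp hT'
    refine tendsto_nhds_unique h2 (h3.congr fun N => ?_)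
    exact (adjoint_berezinKernel_comp_ncPartialSum f hm hT hpure _ N).symm
  ext1 ξ
  refine tendsto_nhds_unique (((adjoint (berezinKernel f m T)).continuous.tendsto _).comp
    (tendsto_ampl_dilation hg hD ξ)) ?_
  refine (tendsto_berezinTransform_dilation T hg hD
    (adjoint (berezinKernel f m T) ξ)).congr' ?_
  filter_upwards [Ioo_mem_nhdsLT (one_pos : (0 : ℝ) < 1)] with r hr
  exact (congrArg (fun A => A ξ) (h1 r hr)).symm

/-- The Berezin transform restricted to the Hardy algebra, as an algebra homomorphism. -/
def berezinAlgHom (f : PosRegularSeries n) {m : ℕ} (hm : 1 ≤ m)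
    {T : Fin n → H →L[ℂ] H} (hT : T ∈ ncDomain f m H) (hpure : IsPure f T) :
    hardyAlgebra f m →ₐ[ℂ] (H →L[ℂ] H) :=
  AlgHom.ofLinearMap ((berezinLinear f m T).comp (hardyAlgebra f m).val.toLinearMap)
    (by
      change berezinTransform f m T 1 = 1
      rw [berezinTransform_eq, ContinuousLinearMap.one_def, ampl_id, ContinuousLinearMap.id_comp]
      exact adjoint_berezinKernel_comp_self f hm hT hpure)
    (by
      rintro ⟨g, c, hg⟩ ⟨h, d, hh⟩
      change berezinTransform f m T (g ∘L h) =
        berezinTransform f m T g ∘L berezinTransform f m T h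
      -- `K* (g ⊗ I)(h ⊗ I) K = Ψ(g) K* (h ⊗ I) K`: the intertwining for `g` is all that
      -- multiplicativity needs.
      rw [berezinTransform_eq f m T (g ∘L h), ampl_comp, ContinuousLinearMap.comp_assoc,
        ← ContinuousLinearMap.comp_assoc, adjoint_berezinKernel_comp_ampl hm hT hpure hg,
        ContinuousLinearMap.comp_assoc, ← berezinTransform_eq])

theorem berezinAlgHom_apply (f : PosRegularSeries n) {m : ℕ} (hm : 1 ≤ m)
    {T : Fin n → H →L[ℂ] H} (hT : T ∈ ncDomain f m H) (hpure : IsPure f T)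
    (g : hardyAlgebra f m) : berezinAlgHom f hm hT hpure g = berezinTransform f m T g := rfl

/-- The matrix `[Ψ(x_ij)]` is `[x_ij ⊗ I]` between an entrywise `K`, which preserves norms, and an
entrywise contraction `K*`. -/
theorem isCompletelyContractive_berezinAlgHom (f : PosRegularSeries n) {m : ℕ} (hm : 1 ≤ m)
    {T : Fin n → H →L[ℂ] H} (hT : T ∈ ncDomain f m H) (hpure : IsPure f T) :
    IsCompletelyContractive (berezinAlgHom f hm hT hpure).toLinearMap := by
  intro k x
  refine ContinuousLinearMap.opNorm_le_bound _ (norm_nonneg _) fun y => ?_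
  refine abs_le_of_sq_le_sq' ?_ (by positivity) |>.2
  rw [mul_pow, PiLp.norm_sq_eq_of_L2, PiLp.norm_sq_eq_of_L2]
  have hK : ‖adjoint (berezinKernel f m T)‖ ≤ 1 := by
    rw [LinearIsometryEquiv.norm_map]; exact norm_berezinKernel_le f hm hT hpure
  have h1 := sum_norm_sq_ampl_le (x.map fun z => (z : Fock n →L[ℂ] Fock n))
    fun j => berezinKernel f m T (y j)
  simp only [norm_berezinKernel_apply f hm hT hpure] at h1
  refine le_trans (Finset.sum_le_sum fun i _ => ?_) h1
  have h2 : matrixOp (x.map (berezinAlgHom f hm hT hpure).toLinearMap) y i =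
      adjoint (berezinKernel f m T) (∑ j, ampl H ((x.map fun z => (z : Fock n →L[ℂ] Fock n)) i j)
        (berezinKernel f m T (y j))) := by
    rw [matrixOp_apply, map_sum]
    rfl
  rw [h2]
  gcongr
  exact ((adjoint (berezinKernel f m T)).le_of_opNorm_le hK _).trans_eq (one_mul _)

end Transform
end

theorem theorem3p4 {n m : ℕ} (hn : 1 ≤ n) (hm : 1 ≤ m)
    {H : Type*} [NormedAddCommGroup H] [InnerProductSpace ℂ H] [CompleteSpace H]
    (f : PosRegularSeries n) (ρ : ℝ) (hρ : 0 < ρ) (hf : f.FreeHolomorphicOn H ρ)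
    (T : Fin n → H →L[ℂ] H) (hT : T ∈ ncDomain f m H) (hpure : IsPure f T) :
    -- the Berezin kernel at `T` is well defined
    (∀ h, HasSum (kernelTerm f m T h) (berezinKernel f m T h)) ∧
    -- the Hardy algebra is a unital algebra `A`, and the restriction `Ψ` of the Berezin transform
    -- to it is a unital algebra homomorphism
    ∃ A : Subalgebra ℂ (Fock n →L[ℂ] Fock n), (A : Set (Fock n →L[ℂ] Fock n)) = hardySet f m ∧
    ∃ Ψ : A →ₐ[ℂ] (H →L[ℂ] H), (∀ g : A, Ψ g = berezinTransform f m T g) ∧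
      -- (i) continuity on bounded sets
      (∀ S ⊆ hardySet f m, Bornology.IsBounded S →
        @ContinuousOn _ _ (wot (Fock n)) (wot H) (berezinTransform f m T) S ∧
        @ContinuousOn _ _ (sot (Fock n)) (sot H) (berezinTransform f m T) S) ∧
      -- (ii)
      IsCompletelyContractive Ψ.toLinearMap ∧
      (∀ α : List (Fin n), ∃ hα : wordOp (weightedShift f m) α ∈ A,
        Ψ ⟨wordOp (weightedShift f m) α, hα⟩ = wordOp T α) ∧
      -- radial limits
      (HasRadialProperty f m (weightedShift f m) →
        ∀ (g : A) (c : List (Fin n) → ℂ), HasFourierRep f m (g : Fock n →L[ℂ] Fock n) c →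
          ∃ G : ℝ → H →L[ℂ] H,
            (∀ r ∈ Set.Ioo (0 : ℝ) 1,
              Tendsto (ncPartialSum c (fun i => (r : ℂ) • T i)) atTop (𝓝 (G r))) ∧
            ∀ x : H, Tendsto (fun r => G r x) (𝓝[<] 1) (𝓝 (Ψ g x))) := by
  refine ⟨hasSum_kernelTerm f hm hT hpure, hardyAlgebra f m, rfl, berezinAlgHom f hm hT hpure,
    berezinAlgHom_apply f hm hT hpure, fun S _ hS => ⟨continuousOn_wot_berezinTransform f m T hS,
      continuousOn_sot_berezinTransform f m T hS⟩,
    isCompletelyContractive_berezinAlgHom f hm hT hpure, fun α => ⟨⟨_, hasFourierRep_wordOp f m α⟩,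
      berezinTransform_of_intertwine f hm hT hpure
        (adjoint_berezinKernel_comp_wordOp f hm hT hpure α)⟩, fun _ g c hg => ?_⟩
  -- The values `g(rT)` are the transforms of the dilations. `D` is constrained only on `(0, 1)`,
  -- which is all that the limit from the left at `1` sees.
  obtain ⟨D, hD⟩ := exists_dilations hg
  exact ⟨fun r => berezinTransform f m T (D r),
    fun r hr => tendsto_ncPartialSum_dilation f hm hT hpure hg hr (hD r hr).2,
    tendsto_berezinTransform_dilation T hg hD⟩
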